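/- **Setting.** A Boolean function is a map $f:\{0,1\}^n\to\{0,1\}$ with $n\ge 0$. For a set $B$ of Boolean functions, $[B]$ denotes the smallest clone containing $B$, i.e. the smallest set of Boolean functions that contains $B$ and all projections and is closed under composition, where constants of arity $0$ and of arity $1$ are identified. For a finite set $B$, the $B$-concepts are given by $$C ::= A \mid f(C,\dots,C) \mid \exists R.C \mid \forall R.C ,$$ where $A$ is an atomic concept name, $R$ a role name and $f\in B$. They have the standard $\mathcal{ALC}$ semantics over interpretations $\mathcal I$ with nonempty domain $\Delta^{\mathcal I}$; in particular $f(C_1,\dots,C_n)^{\mathcal I}$ is the set of all $x\in\Delta^{\mathcal I}$ such that $f$ takes the value $1$ on the truth values of $x\in C_1^{\mathcal I},\dots,x\in C_n^{\mathcal I}$. A TBox is a finite set of inclusions $C\sqsubseteq D$. An ontology is a finite set of inclusions $C\sqsubseteq D$ and assertions $C(a)$, $R(a,b)$, with $a,b$ individual names. Consider the following decision problems. - $\mathrm{TSAT}(B)$: given a TBox $\mathcal T$ over $B$, does $\mathcal T$ have a model? - $\mathrm{TCSAT}(B)$: given a TBox $\mathcal T$ over $B$ and a $B$-concept $C$, does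 $\mathcal T$ have a model $\mathcal I$ with $C^{\mathcal I}\neq\emptyset$? - $\mathrm{OSAT}(B)$: given an ontology $\mathcal O$ over $B$, does $\mathcal O$ have a model? - $\mathrm{OCSAT}(B)$: given an ontology $\mathcal O$ over $B$ and a $B$-concept $C$, does $\mathcal O$ have a model $\mathcal I$ with $C^{\mathcal I}\neq\emptyset$? **Lemma.** Let $B_1,B_2$ be finite sets of Boolean functions with $[B_1]=[B_2]$. Then each of the four problems over $B_1$ is logspace many-one reducible to the same problem over $B_2$: $$\mathrm{TSAT}(B_1)\le_m^{\log}\mathrm{TSAT}(B_2),\quad \mathrm{TCSAT}(B_1)\le_m^{\log}\mathrm{TCSAT}(B_2),\quad \mathrm{OSAT}(B_1)\le_m^{\log}\mathrm{OSAT}(B_2),\quad \mathrm{OCSAT}(B_1)\le_m^{\log}\mathrm{OCSAT}(B_2).$$ -/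

import Mathlib

/-! ## Boolean functions and clones -/

/-- A Boolean function of arbitrary arity `n ≥ 0` (the arity is the first component). -/
abbrev BoolFun : Type := Σ n : ℕ, (Fin n → Bool) → Bool

/-- A set of Boolean functions is a clone if it is closed under superposition: it contains all
projections and is closed under composition. Constants of arity 0 are identified with
constants of arity 1 (composition turns the former into the latter, the last clause is the
converse). -/
def IsClone (C : Set BoolFun) : Prop :=
  (∀ (n : ℕ) (i : Fin n), (⟨n, fun x => x i⟩ : BoolFun) ∈ C) ∧
  (∀ (n m : ℕ) (f : (Fin n → Bool) → Bool) (g : Fin n → (Fin m → Bool) → Bool),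
    (⟨n, f⟩ : BoolFun) ∈ C → (∀ i, (⟨m, g i⟩ : BoolFun) ∈ C) →
      (⟨m, fun x => f (fun i => g i x)⟩ : BoolFun) ∈ C) ∧
  (∀ b : Bool, (⟨1, fun _ => b⟩ : BoolFun) ∈ C → (⟨0, fun _ => b⟩ : BoolFun) ∈ C)

/-- `[B]`, the smallest clone containing `B`. -/
def cloneOf (B : Set BoolFun) : Set BoolFun := ⋂₀ {C | IsClone C ∧ B ⊆ C}

/-! ## Logspace many-one reductions -/

/-- The content of a cell of the read-only input tape, which is delimited by two end markers. -/
inductive InputCell (α : Type) : Type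
  | leftEnd : InputCell α
  | letter : α → InputCell α
  | rightEnd : InputCell α

/-- Moves of a tape head. -/
inductive HeadMove : Type
  | left : HeadMove
  | stay : HeadMove
  | right : HeadMove

/-- A deterministic Turing machine with a two-way read-only input tape, `k` one-way infinite
work tapes over a finite alphabet, and a write-only output tape. In one step it reads the scanned
cells, changes its state, moves the input head, writes to and moves on each work tape, and appends
at most one letter to the output; `none` means that it halts. -/
structure Transducer (α β : Type) where
  State : Type
  finState : Finite State
  Work : Type
  finWork : Finite Work
  blank : Work
  k : ℕ
  start : State
  trans : State → InputCell α → (Fin k → Work) →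
    Option (State × HeadMove × (Fin k → Work × HeadMove) × Option β)

namespace Transducer

variable {α β : Type}

/-- The cell at position `p` of the input tape: the left end marker at `0`, the letters of `w` at
`1, …, |w|`, and the right end marker at `|w| + 1`. -/
def readInput (w : List α) : ℕ → InputCell α
  | 0 => InputCell.leftEnd
  | p + 1 => match w[p]? with
    | some a => InputCell.letter a
    | none => InputCell.rightEnd

/-- The input head cannot leave the positions `0, …, |w| + 1`. -/
def moveInput (w : List α) : HeadMove → ℕ → ℕ
  | HeadMove.left, p => p - 1
  | HeadMove.stay, p => p
  | HeadMove.right, p => min (p + 1) (w.length + 1)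

/-- A work head has no effect when it is moved to the left of cell `0`. -/
def moveWork : HeadMove → ℕ → ℕ
  | HeadMove.left, p => p - 1
  | HeadMove.stay, p => p
  | HeadMove.right, p => p + 1

/-- A configuration: state, input head position, contents and head positions of the work tapes,
and the output written so far. -/
structure Cfg (M : Transducer α β) where
  state : M.State
  inputPos : ℕ
  tape : Fin M.k → ℕ → M.Work
  head : Fin M.k → ℕ
  output : List β

/-- The initial configuration. -/
def init (M : Transducer α β) : M.Cfg where
  state := M.start
  inputPos := 0
  tape := fun _ _ => M.blank
  head := fun _ => 0
  output := []

/-- One step of the machine on the input word `w`; `none` if the configuration is halting. -/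
def step (M : Transducer α β) (w : List α) (c : M.Cfg) : Option M.Cfg :=
  (M.trans c.state (readInput w c.inputPos) (fun i => c.tape i (c.head i))).map fun r =>
    { state := r.1
      inputPos := moveInput w r.2.1 c.inputPos
      tape := fun i => Function.update (c.tape i) (c.head i) (r.2.2.1 i).1
      head := fun i => moveWork (r.2.2.1 i).2 (c.head i)
      output := c.output ++ r.2.2.2.toList }

/-- The configuration `c` occurs in the run of the machine on `w`. -/
def Reachable (M : Transducer α β) (w : List α) (c : M.Cfg) : Prop :=
  Relation.ReflTransGen (fun a b => M.step w a = some b) M.init c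

/-- On every input `w` the machine halts with output `f w`. -/
def Computes (M : Transducer α β) (f : List α → List β) : Prop :=
  ∀ w : List α, ∃ c : M.Cfg, M.Reachable w c ∧ M.step w c = none ∧ c.output = f w

/-- On inputs of length `n` the machine visits only the first `O(log n)` cells of each work tape
(`+ 1` takes care of small `n`). Neither the input nor the output counts as space. -/
def UsesLogSpace (M : Transducer α β) : Prop :=
  ∃ K : ℕ, ∀ (w : List α) (c : M.Cfg), M.Reachable w c →
    ∀ i : Fin M.k, c.head i < K * (Nat.log 2 w.length + 1)

end Transducer

/-- The function `f` on words over finite alphabets is computable in logarithmic space. -/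
def LogspaceComputable {α β : Type} [Finite α] [Finite β] (f : List α → List β) : Prop :=
  ∃ M : Transducer α β, M.Computes f ∧ M.UsesLogSpace

/-- Logspace many-one reducibility between languages over finite alphabets. -/
def LogspaceReducible {α β : Type} [Finite α] [Finite β] (L₁ : Language α) (L₂ : Language β) :
    Prop :=
  ∃ f : List α → List β, LogspaceComputable f ∧ ∀ w : List α, w ∈ L₁ ↔ f w ∈ L₂

/-! ## The description logic -/

namespace ALC

/-- Names of atomic concepts, of roles, and of individuals are bit strings. (The three sorts of
names are kept apart by the places where they occur.) -/
abbrev Name : Type := List Bool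

/-- Concepts that use only Boolean operators from `B`. -/
inductive Concept (B : Finset BoolFun) : Type
  | atom : Name → Concept B
  | op : (f : {f : BoolFun // f ∈ B}) → (Fin f.1.1 → Concept B) → Concept B
  | ex : Name → Concept B → Concept B
  | all : Name → Concept B → Concept B

/-- General concept inclusions `C ⊑ D`. -/
structure GCI (B : Finset BoolFun) : Type where
  lhs : Concept B
  rhs : Concept B

/-- Axioms of an ontology: general concept inclusions `C ⊑ D` and the ABox axioms `C(x)` and
`R(x, y)`. -/
inductive OntAxiom (B : Finset BoolFun) : Type
  | inclusion : GCI B → OntAxiom B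
  | conceptAssertion : Concept B → Name → OntAxiom B
  | roleAssertion : Name → Name → Name → OntAxiom B

/-- A TBox is a finite set of general concept inclusions, presented as a list of its elements in
any order. -/
abbrev TBox (B : Finset BoolFun) : Type := List (GCI B)

/-- An ontology is the union of a TBox and an ABox, presented as a list of its axioms in any
order. -/
abbrev Ontology (B : Finset BoolFun) : Type := List (OntAxiom B)

/-- An interpretation. -/
structure Interp : Type 1 where
  Dom : Type
  nonemptyDom : Nonempty Dom
  conc : Name → Set Dom
  role : Name → Dom → Dom → Prop
  ind : Name → Dom

variable {B : Finset BoolFun}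

open Classical in
/-- The extension of a concept in an interpretation. -/
noncomputable def Interp.ext (I : Interp) : Concept B → Set I.Dom
  | .atom A => I.conc A
  | .op f Cs => {x | f.1.2 (fun i => decide (x ∈ I.ext (Cs i))) = true}
  | .ex R C => {x | ∃ y, I.role R x y ∧ y ∈ I.ext C}
  | .all R C => {x | ∀ y, I.role R x y → y ∈ I.ext C}

/-- `I ⊨ C ⊑ D`. -/
def Interp.SatGCI (I : Interp) (a : GCI B) : Prop := I.ext a.lhs ⊆ I.ext a.rhs

/-- `I` satisfies an axiom. -/
def Interp.SatAxiom (I : Interp) : OntAxiom B → Prop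
  | .inclusion a => I.SatGCI a
  | .conceptAssertion C x => I.ind x ∈ I.ext C
  | .roleAssertion R x y => I.role R (I.ind x) (I.ind y)

/-- `I` is a model of the TBox `T`. -/
def Interp.ModelsTBox (I : Interp) (T : TBox B) : Prop := ∀ a ∈ T, I.SatGCI a

/-- `I` is a model of the ontology `O`. -/
def Interp.ModelsOntology (I : Interp) (O : Ontology B) : Prop := ∀ a ∈ O, I.SatAxiom a

/-! ### Encoding of instances as words -/

/-- The letters of the (finite) alphabet in which instances over `B` are written. -/
inductive Letter (B : Finset BoolFun) : Type
  | bit : Bool → Letter B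
  | endName : Letter B
  | atom : Letter B
  | op : {f : BoolFun // f ∈ B} → Letter B
  | ex : Letter B
  | all : Letter B
  | gci : Letter B
  | conceptAssertion : Letter B
  | roleAssertion : Letter B
  | query : Letter B

/-- The alphabet is finite. -/
instance Letter.instFinite (B : Finset BoolFun) : Finite (Letter B) :=
  Finite.of_injective
    (fun l : Letter B => (match l with
      | .bit b => Sum.inl (b, 0)
      | .op f => Sum.inr f
      | .endName => Sum.inl (true, 1)
      | .atom => Sum.inl (true, 2)
      | .ex => Sum.inl (true, 3)
      | .all => Sum.inl (true, 4)
      | .gci => Sum.inl (true, 5)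
      | .conceptAssertion => Sum.inl (true, 6)
      | .roleAssertion => Sum.inl (true, 7)
      | .query => Sum.inl (true, 8) : (Bool × Fin 9) ⊕ {f : BoolFun // f ∈ B}))
    (by
      intro a b h
      cases a <;> cases b <;> simp_all)

/-- A name is written bit by bit and terminated by `endName`. -/
def encName (s : Name) : List (Letter B) := s.map Letter.bit ++ [Letter.endName]

/-- Concepts are written in prefix notation (every operator letter has a fixed arity). -/
def encConcept : Concept B → List (Letter B)
  | .atom A => Letter.atom :: encName A
  | .op f Cs => Letter.op f :: (List.ofFn fun i => encConcept (Cs i)).flatten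
  | .ex R C => Letter.ex :: (encName R ++ encConcept C)
  | .all R C => Letter.all :: (encName R ++ encConcept C)

/-- The word for `C ⊑ D`. -/
def encGCI (a : GCI B) : List (Letter B) :=
  Letter.gci :: (encConcept a.lhs ++ encConcept a.rhs)

/-- The word for an axiom. -/
def encAxiom : OntAxiom B → List (Letter B)
  | .inclusion a => encGCI a
  | .conceptAssertion C x => Letter.conceptAssertion :: (encConcept C ++ encName x)
  | .roleAssertion R x y => Letter.roleAssertion :: (encName R ++ encName x ++ encName y)

/-- The word for a TBox. -/
def encTBox (T : TBox B) : List (Letter B) := T.flatMap encGCI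

/-- The word for an ontology. -/
def encOntology (O : Ontology B) : List (Letter B) := O.flatMap encAxiom

/-- The word for the concept of an instance that consists of a TBox or an ontology and a
concept. -/
def encQuery (C : Concept B) : List (Letter B) := Letter.query :: encConcept C

/-! ### The four satisfiability problems, as languages -/

/-- TBox satisfiability. -/
def TSAT (B : Finset BoolFun) : Language (Letter B) :=
  {w | ∃ T : TBox B, w = encTBox T ∧ ∃ I : Interp, I.ModelsTBox T}

/-- TBox-concept satisfiability. -/
def TCSAT (B : Finset BoolFun) : Language (Letter B) :=
  {w | ∃ (T : TBox B) (C : Concept B), w = encTBox T ++ encQuery C ∧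
    ∃ I : Interp, I.ModelsTBox T ∧ (I.ext C).Nonempty}

/-- Ontology satisfiability. -/
def OSAT (B : Finset BoolFun) : Language (Letter B) :=
  {w | ∃ O : Ontology B, w = encOntology O ∧ ∃ I : Interp, I.ModelsOntology O}

/-- Ontology-concept satisfiability. -/
def OCSAT (B : Finset BoolFun) : Language (Letter B) :=
  {w | ∃ (O : Ontology B) (C : Concept B), w = encOntology O ++ encQuery C ∧
    ∃ I : Interp, I.ModelsOntology O ∧ (I.ext C).Nonempty}

end ALC

/-! Every operator of `B₁` lies in `[B₂]` and is therefore computed by a term over `B₂`. Plugging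
these terms into concepts may cause exponential growth, because a variable can occur several times
in a term. Instead, every occurrence of a subconcept receives an atomic name, and two inclusions
equate this name with a single term or quantifier applied to the names of the immediate subconcepts.
General inclusions are available in all four problems, so one translation serves them all.

The name of an occurrence is the length, in unary, of the suffix of the input word that starts
there. Original atoms get a leading `false`, so they cannot clash with these names. A query becomes
one further atom, included in the name of the queried concept. Terms may contain a dummy variable: a
nullary constant may be available over `B₂` only through a unary constant function, whose argument
must be filled with some concept.

In a model of the translation each name denotes the concept that it abbreviates
(`Interp.ext_pullback`); conversely a model of the source extends to the names
(`Interp.ext_pushforward_numeral`), which is consistent by unique readability of words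
(`encConcept_append_inj`). Words that encode no instance must be mapped to non-instances; they are
detected by an automaton with one counter (`exists_encInstance_of_recognizes`).

For the space bound, each letter is translated by a bounded list of instructions that either emit a
letter or refer to the suffix reached by skipping a bounded number of names and concepts. Skipping
needs one counter of pending items, returning to the letter needs another, and both are linearly
bounded (`ScanProgram.logspaceComputable_eval`). Such counters fit in binary on logarithmically long
work tapes (`CounterMachine.logspaceComputable`). -/

/-! ## Counter machines

A two-way read-only input head together with finitely many counters which can be incremented,
decremented and tested for zero. Such a machine whose counters are linearly bounded is simulated
in logarithmic space by keeping each counter in binary on a work tape. -/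

/-- The instructions of a counter machine. `dec i q₁ q₀` decrements counter `i` and continues at
`q₁`, or continues at `q₀` if the counter is zero. -/
inductive CounterInstr (α β Q : Type) (k : ℕ) : Type
  | read : (InputCell α → Option (Q × HeadMove × Option β)) → CounterInstr α β Q k
  | inc : Fin k → Q → CounterInstr α β Q k
  | dec : Fin k → Q → Q → CounterInstr α β Q k

/-- A counter machine with an input head, `k` counters and an output tape. -/
structure CounterMachine (α β : Type) where
  State : Type
  finState : Finite State
  k : ℕ
  start : State
  prog : State → CounterInstr α β State k

namespace CounterMachine

variable {α β : Type}

/-- A configuration: state, input head position, counter values, output. -/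
structure Cfg (M : CounterMachine α β) where
  state : M.State
  pos : ℕ
  cnt : Fin M.k → ℕ
  output : List β

/-- The initial configuration. -/
def init (M : CounterMachine α β) : M.Cfg := ⟨M.start, 0, fun _ => 0, []⟩

/-- One step of the machine; `none` if the configuration is halting. -/
def step (M : CounterMachine α β) (w : List α) (c : M.Cfg) : Option M.Cfg :=
  match M.prog c.state with
  | .read g => (g (Transducer.readInput w c.pos)).map fun r =>
      ⟨r.1, Transducer.moveInput w r.2.1 c.pos, c.cnt, c.output ++ r.2.2.toList⟩
  | .inc i q => some ⟨q, c.pos, Function.update c.cnt i (c.cnt i + 1), c.output⟩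
  | .dec i q₁ q₀ =>
      if c.cnt i = 0 then some ⟨q₀, c.pos, c.cnt, c.output⟩
      else some ⟨q₁, c.pos, Function.update c.cnt i (c.cnt i - 1), c.output⟩

/-- Runs during which no counter exceeds `N`. -/
def Run (M : CounterMachine α β) (w : List α) (N : ℕ) : M.Cfg → M.Cfg → Prop :=
  Relation.ReflTransGen fun a b => M.step w a = some b ∧ ∀ i, b.cnt i ≤ N

theorem Run.append {M : CounterMachine α β} {w : List α} {N : ℕ} {a b c : M.Cfg}
    (h : M.Run w N a b) (h' : M.Run w N b c) : M.Run w N a c :=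
  Relation.ReflTransGen.trans h h'

/-! ### Binary counters -/

/-- The number with the given binary digits, least significant digit first. -/
def binVal : List Bool → ℕ
  | [] => 0
  | b :: r => b.toNat + 2 * binVal r

/-- Increment of a binary number. -/
def binInc : List Bool → List Bool
  | [] => [true]
  | false :: r => true :: r
  | true :: r => false :: binInc r

/-- Decrement of a binary number, `none` for zero. -/
def binDec : List Bool → Option (List Bool)
  | [] => none
  | true :: r => some (false :: r)
  | false :: r => (binDec r).map (true :: ·)

theorem binVal_binInc (ds : List Bool) : binVal (binInc ds) = binVal ds + 1 := by
  induction ds with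
  | nil => rfl
  | cons b r ih => cases b <;> simp [binInc, binVal, ih] <;> omega

/-- Only a block of ones grows, and its value is one less than a power of two. Hence a counter below
`2 ^ L` never outgrows `L` digits, although leading zeros are never removed. -/
theorem length_binInc (ds : List Bool) :
    (binInc ds).length = ds.length ∨
      (binInc ds).length = ds.length + 1 ∧ 2 ^ ds.length = binVal ds + 1 := by
  induction ds with
  | nil => right; simp [binInc, binVal]
  | cons b r ih =>
    cases b
    · left; simp [binInc]
    · rcases ih with ih | ⟨ih, ih'⟩
      · left; simp [binInc, ih]
      · right; simp [binInc, ih, binVal, pow_succ, ih']; omega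

/-- Zero may be stored with leading zeros, since decrementing keeps the length. The explicit form of
the list shows that the tape is restored after a failed borrow. -/
theorem binDec_eq_none {ds : List Bool} (h : binDec ds = none) :
    ds = List.replicate ds.length false ∧ binVal ds = 0 := by
  induction ds with
  | nil => simp [binVal]
  | cons b r ih =>
    cases b
    · simp only [binDec, Option.map_eq_none_iff] at h
      obtain ⟨h1, h2⟩ := ih h
      refine ⟨?_, by simp [binVal, h2]⟩
      rw [List.length_cons, List.replicate_succ, ← h1]
    · simp [binDec] at h

theorem binDec_eq_some {ds es : List Bool} (h : binDec ds = some es) :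
    es.length = ds.length ∧ binVal ds = binVal es + 1 := by
  induction ds generalizing es with
  | nil => simp [binDec] at h
  | cons b r ih =>
    cases b
    · simp only [binDec, Option.map_eq_some_iff] at h
      obtain ⟨t, ht, rfl⟩ := h
      obtain ⟨h1, h2⟩ := ih ht
      refine ⟨by simp [h1], ?_⟩
      simp [binVal, h2]; omega
    · simp only [binDec, Option.some.injEq] at h
      subst h
      refine ⟨by simp, ?_⟩
      simp [binVal]; omega

/-! ### The simulating transducer -/

/-- Work tape letters: `none` is the blank, `some none` marks the left end, and `some (some b)` is a
binary digit. -/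
abbrev Sym : Type := Option (Option Bool)

/-- The states of the simulating transducer. -/
inductive SimState (Q : Type) (k : ℕ) : Type
  | init : SimState Q k
  | ready : Q → SimState Q k
  | carry : Fin k → Q → SimState Q k
  | borrow : Fin k → Q → Q → SimState Q k
  | back : Fin k → Bool → Q → SimState Q k

instance (Q : Type) (k : ℕ) [Finite Q] : Finite (SimState Q k) :=
  Finite.of_injective
    (fun s : SimState Q k => (match s with
      | .init => Sum.inl none
      | .ready q => Sum.inl (some q)
      | .carry i q => Sum.inr (Sum.inl (i, q))
      | .borrow i q r => Sum.inr (Sum.inr (Sum.inl (i, q, r)))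
      | .back i z q => Sum.inr (Sum.inr (Sum.inr (i, z, q))) :
      Option Q ⊕ (Fin k × Q) ⊕ (Fin k × Q × Q) ⊕ (Fin k × Bool × Q)))
    (by
      intro a b h
      cases a <;> cases b <;> simp_all)

/-- Write `s` on tape `i` and move its head; keep the other tapes. -/
def actOn {k : ℕ} (t : Fin k → Sym) (i : Fin k) (s : Sym) (m : HeadMove) :
    Fin k → Sym × HeadMove :=
  Function.update (fun j => (t j, HeadMove.stay)) i (s, m)

/-- The transition function of the simulating transducer. -/
def simTrans (M : CounterMachine α β) :
    SimState M.State M.k → InputCell α → (Fin M.k → Sym) →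
      Option (SimState M.State M.k × HeadMove × (Fin M.k → Sym × HeadMove) × Option β)
  | .init, _, _ => some (.ready M.start, .stay, fun _ => (some none, .right), none)
  | .ready q, a, t =>
    match M.prog q with
    | .read g => (g a).map fun r => (.ready r.1, r.2.1, fun j => (t j, .stay), r.2.2)
    | .inc i q' => some (.carry i q', .stay, fun j => (t j, .stay), none)
    | .dec i q₁ q₀ => some (.borrow i q₁ q₀, .stay, fun j => (t j, .stay), none)
  | .carry i q, _, t =>
    if t i = some (some true) then
      some (.carry i q, .stay, actOn t i (some (some false)) .right, none)
    else some (.back i false q, .stay, actOn t i (some (some true)) .stay, none)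
  | .borrow i q₁ q₀, _, t =>
    match t i with
    | some (some false) => some (.borrow i q₁ q₀, .stay, actOn t i (some (some true)) .right, none)
    | some (some true) => some (.back i false q₁, .stay, actOn t i (some (some false)) .stay, none)
    | s => some (.back i true q₀, .stay, actOn t i s .stay, none)
  | .back i z q, _, t =>
    match t i with
    | some none => some (.ready q, .stay, actOn t i (some none) .right, none)
    -- A failed borrow has turned every zero into a one. The flag `z` makes the return walk write
    -- zeros again.
    | some (some b) => some (.back i z q, .stay, actOn t i (some (some (!z && b))) .left, none)
    | none => some (.back i z q, .stay, actOn t i none .left, none)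

/-- The transducer that simulates a counter machine. -/
abbrev toTransducer (M : CounterMachine α β) : Transducer α β where
  State := SimState M.State M.k
  finState := haveI := M.finState; inferInstance
  Work := Sym
  finWork := inferInstance
  blank := none
  k := M.k
  start := .init
  trans := M.simTrans

/-- The work tape holding the binary digits `ds`. -/
def tapeOf (ds : List Bool) : ℕ → Sym
  | 0 => some none
  | j + 1 => ds[j]?.map some

theorem update_tapeOf (pre : List Bool) (b c : Bool) (r : List Bool) :
    Function.update (tapeOf (pre ++ b :: r)) (pre.length + 1) (some (some c)) =
      tapeOf (pre ++ c :: r) := by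
  ext1 j
  rcases j with _ | j
  · simp [tapeOf]
  · by_cases h : j = pre.length
    · subst h; simp [tapeOf]
    · rw [Function.update_of_ne (by omega)]
      simp only [tapeOf, List.getElem?_append]
      split
      · rfl
      · obtain ⟨m, hm⟩ : ∃ m, j - pre.length = m + 1 := ⟨j - pre.length - 1, by omega⟩
        simp [hm]

theorem update_tapeOf_end (pre : List Bool) (c : Bool) :
    Function.update (tapeOf pre) (pre.length + 1) (some (some c)) = tapeOf (pre ++ [c]) := by
  ext1 j
  rcases j with _ | j
  · simp [tapeOf]
  · by_cases h : j = pre.length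
    · subst h; simp [tapeOf]
    · rw [Function.update_of_ne (by omega)]
      simp only [tapeOf, List.getElem?_append]
      split
      · rfl
      · have h1 : pre.length ≤ j := by omega
        obtain ⟨m, hm⟩ : ∃ m, j - pre.length = m + 1 := ⟨j - pre.length - 1, by omega⟩
        simp [hm, h1]

theorem tapeOf_at (pre r : List Bool) (b : Bool) :
    tapeOf (pre ++ b :: r) (pre.length + 1) = some (some b) := by simp [tapeOf]

theorem tapeOf_end (pre : List Bool) : tapeOf pre (pre.length + 1) = none := by simp [tapeOf]

/-- A configuration of the simulating transducer in which only tape `i` is in use. -/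
def simCfg (M : CounterMachine α β) (s : SimState M.State M.k) (p : ℕ) (o : List β)
    (T : Fin M.k → ℕ → Sym) (i : Fin M.k) (X : ℕ → Sym) (h : ℕ) : M.toTransducer.Cfg where
  state := s
  inputPos := p
  tape := Function.update T i X
  head := Function.update (fun _ => 1) i h
  output := o

/-- During a walk only the symbol on tape `i` matters, so `hs` leaves the input cell and the symbols
on the other tapes arbitrary. -/
theorem step_simCfg (M : CounterMachine α β) (w : List α) {s s' : SimState M.State M.k} (p : ℕ)
    (o : List β) (T : Fin M.k → ℕ → Sym) (i : Fin M.k) (X : ℕ → Sym) (h : ℕ) (y : Sym)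
    (m : HeadMove)
    (hs : ∀ a t, t i = X h → M.simTrans s a t = some (s', .stay, actOn t i y m, none)) :
    M.toTransducer.step w (M.simCfg s p o T i X h) =
      some (M.simCfg s' p o T i (Function.update X h y) (Transducer.moveWork m h)) := by
  simp only [Transducer.step, toTransducer, simCfg]
  rw [hs _ _ (by simp)]
  simp only [Option.map_some, Option.some.injEq, Transducer.Cfg.mk.injEq, true_and]
  refine ⟨rfl, ?_, ?_, by simp⟩
  · funext j
    by_cases hj : j = i
    · subst hj; simp [actOn]
    · simp [actOn, hj]
  · funext j
    by_cases hj : j = i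
    · subst hj; simp [actOn]
    · simp [actOn, hj, Transducer.moveWork]

/-- Runs of the simulating transducer that only visit the first `L + 2` cells of each tape. -/
def SimRun (M : CounterMachine α β) (w : List α) (L : ℕ) :
    M.toTransducer.Cfg → M.toTransducer.Cfg → Prop :=
  Relation.ReflTransGen fun a b => M.toTransducer.step w a = some b ∧ ∀ i, b.head i ≤ L + 1

theorem SimRun.append {M : CounterMachine α β} {w : List α} {L : ℕ} {a b c : M.toTransducer.Cfg}
    (h : M.SimRun w L a b) (h' : M.SimRun w L b c) : M.SimRun w L a c :=
  Relation.ReflTransGen.trans h h'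

/-! ### Carry, borrow and return walks on a single work tape. -/

section Walks

variable (M : CounterMachine α β) (w : List α) (p : ℕ) (o : List β) (T : Fin M.k → ℕ → Sym)
  (i : Fin M.k) {L : ℕ}

theorem simCfg_head_le {s : SimState M.State M.k} {X : ℕ → Sym} {h : ℕ} (hL : h ≤ L + 1)
    (j : Fin M.k) : (M.simCfg s p o T i X h).head j ≤ L + 1 := by
  by_cases hj : j = i
  · subst hj; simpa [simCfg] using hL
  · simp [simCfg, hj]

theorem simRun_single {s s' : SimState M.State M.k} {X : ℕ → Sym} {h : ℕ} (y : Sym)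
    (m : HeadMove)
    (hs : ∀ a t, t i = X h → M.simTrans s a t = some (s', .stay, actOn t i y m, none))
    (hL : Transducer.moveWork m h ≤ L + 1) :
    M.SimRun w L (M.simCfg s p o T i X h)
      (M.simCfg s' p o T i (Function.update X h y) (Transducer.moveWork m h)) :=
  Relation.ReflTransGen.single ⟨M.step_simCfg w p o T i X h y m hs, M.simCfg_head_le p o T i hL⟩

/-- Cell `0` holds the marker, so cell `pre.length` holds the last digit of `pre`. The head moves
left, hence the induction removes digits of `pre` from the right. -/
theorem simRun_back (q : M.State) (pre r : List Bool) (hL : pre.length ≤ L) :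
    M.SimRun w L (M.simCfg (.back i false q) p o T i (tapeOf (pre ++ r)) pre.length)
      (M.simCfg (.ready q) p o T i (tapeOf (pre ++ r)) 1) := by
  induction pre using List.reverseRecOn generalizing r with
  | nil =>
    have := M.simRun_single w p o T i (L := L) (s := .back i false q) (s' := .ready q)
      (X := tapeOf r) (h := 0) (some none) .right
      (by intro a t ht; simp only [tapeOf] at ht; simp [simTrans, ht])
      (by simp [Transducer.moveWork])
    have e : Function.update (tapeOf r) 0 (some none) = tapeOf r :=
      Function.update_eq_self_iff.2 rfl
    rwa [e] at this
  | append_singleton pre b ih =>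
    simp only [List.append_assoc, List.singleton_append, List.length_append, List.length_cons,
      List.length_nil, zero_add] at hL ⊢
    have := M.simRun_single w p o T i (L := L) (s := .back i false q) (s' := .back i false q)
      (X := tapeOf (pre ++ b :: r)) (h := pre.length + 1) (some (some b)) .left
      (by intro a t ht; rw [tapeOf_at] at ht; simp [simTrans, ht])
      (by simp [Transducer.moveWork]; omega)
    rw [update_tapeOf] at this
    exact this.append (ih (b :: r) (by omega))

theorem simRun_back_clear (q : M.State) (pre r : List Bool) (hL : pre.length ≤ L) :
    M.SimRun w L (M.simCfg (.back i true q) p o T i (tapeOf (pre ++ r)) pre.length)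
      (M.simCfg (.ready q) p o T i (tapeOf (List.replicate pre.length false ++ r)) 1) := by
  induction pre using List.reverseRecOn generalizing r with
  | nil =>
    have := M.simRun_single w p o T i (L := L) (s := .back i true q) (s' := .ready q)
      (X := tapeOf r) (h := 0) (some none) .right
      (by intro a t ht; simp only [tapeOf] at ht; simp [simTrans, ht])
      (by simp [Transducer.moveWork])
    have e : Function.update (tapeOf r) 0 (some none) = tapeOf r :=
      Function.update_eq_self_iff.2 rfl
    rwa [e] at this
  | append_singleton pre b ih =>
    simp only [List.append_assoc, List.singleton_append, List.length_append, List.length_cons,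
      List.length_nil, zero_add, List.replicate_succ'] at hL ⊢
    have := M.simRun_single w p o T i (L := L) (s := .back i true q) (s' := .back i true q)
      (X := tapeOf (pre ++ b :: r)) (h := pre.length + 1) (some (some false)) .left
      (by intro a t ht; rw [tapeOf_at] at ht; simp [simTrans, ht])
      (by simp [Transducer.moveWork]; omega)
    rw [update_tapeOf] at this
    exact this.append (ih (false :: r) (by omega))

/-- A carry stops at a zero digit or at the blank after the last digit. Keeping the tape `X`
abstract treats both cases at once. -/
theorem simRun_carry_end (q : M.State) {X : ℕ → Sym} {pre : List Bool} (r : List Bool)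
    (hl : (pre ++ true :: r).length ≤ L) (hne : X (pre.length + 1) ≠ some (some true))
    (he : Function.update X (pre.length + 1) (some (some true)) = tapeOf (pre ++ true :: r)) :
    M.SimRun w L (M.simCfg (.carry i q) p o T i X (pre.length + 1))
      (M.simCfg (.ready q) p o T i (tapeOf (pre ++ true :: r)) 1) := by
  have h1 := M.simRun_single w p o T i (L := L) (s := .carry i q) (s' := .back i false q)
    (X := X) (h := pre.length + 1) (some (some true)) .stay
    (by intro a t ht; simp only [simTrans, ht, hne, if_false])
    (by simp at hl; simp [Transducer.moveWork]; omega)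
  rw [he] at h1
  refine h1.append ?_
  have := M.simRun_back w p o T i (L := L) q (pre ++ [true]) r (by simp at hl ⊢; omega)
  simpa [Transducer.moveWork] using this

/-- The list `pre` collects the digits already rewritten by the carry, and the head stands on the
first digit of `r`. -/
theorem simRun_carry (q : M.State) (pre r : List Bool)
    (hL : (pre ++ binInc r).length ≤ L) :
    M.SimRun w L (M.simCfg (.carry i q) p o T i (tapeOf (pre ++ r)) (pre.length + 1))
      (M.simCfg (.ready q) p o T i (tapeOf (pre ++ binInc r)) 1) := by
  induction r generalizing pre with
  | nil =>
    refine M.simRun_carry_end w p o T i q [] (by simpa [binInc] using hL) (by simp [tapeOf]) ?_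
    rw [List.append_nil, update_tapeOf_end]
  | cons b r ih =>
    cases b
    · exact M.simRun_carry_end w p o T i q r (by simpa [binInc] using hL) (by simp [tapeOf])
        (update_tapeOf ..)
    · have hl : (pre ++ false :: binInc r).length ≤ L := hL
      have h1 := M.simRun_single w p o T i (L := L) (s := .carry i q) (s' := .carry i q)
        (X := tapeOf (pre ++ true :: r)) (h := pre.length + 1) (some (some false)) .right
        (by intro a t ht; rw [tapeOf_at] at ht; simp [simTrans, ht])
        (by simp at hl; simp [Transducer.moveWork]; omega)
      rw [update_tapeOf] at h1
      refine h1.append ?_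
      simpa [binInc, Transducer.moveWork] using ih (pre ++ [false]) (by simpa using hl)

theorem simRun_borrow_some (q₁ q₀ : M.State) (pre r r' : List Bool) (h : binDec r = some r')
    (hL : (pre ++ r).length ≤ L) :
    M.SimRun w L (M.simCfg (.borrow i q₁ q₀) p o T i (tapeOf (pre ++ r)) (pre.length + 1))
      (M.simCfg (.ready q₁) p o T i (tapeOf (pre ++ r')) 1) := by
  induction r generalizing pre r' with
  | nil => simp [binDec] at h
  | cons b r ih =>
    simp only [List.length_append, List.length_cons] at hL
    cases b
    · simp only [binDec, Option.map_eq_some_iff] at h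
      obtain ⟨t, ht, rfl⟩ := h
      have h1 := M.simRun_single w p o T i (L := L) (s := .borrow i q₁ q₀)
        (s' := .borrow i q₁ q₀)
        (X := tapeOf (pre ++ false :: r)) (h := pre.length + 1) (some (some true)) .right
        (by intro a t ht; rw [tapeOf_at] at ht; simp [simTrans, ht])
        (by simp [Transducer.moveWork]; omega)
      rw [update_tapeOf] at h1
      refine h1.append ?_
      simpa [Transducer.moveWork] using ih (pre ++ [true]) t ht (by simp; omega)
    · simp only [binDec, Option.some.injEq] at h
      subst h
      have h1 := M.simRun_single w p o T i (L := L) (s := .borrow i q₁ q₀)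
        (s' := .back i false q₁)
        (X := tapeOf (pre ++ true :: r)) (h := pre.length + 1) (some (some false)) .stay
        (by intro a t ht; rw [tapeOf_at] at ht; simp [simTrans, ht])
        (by simp [Transducer.moveWork]; omega)
      rw [update_tapeOf] at h1
      refine h1.append ?_
      simpa [Transducer.moveWork] using
        M.simRun_back w p o T i (L := L) q₁ (pre ++ [false]) r (by simp; omega)

/-- The borrow runs off the end of a block of zeros, leaving ones behind it in `pre`. The clearing
return walk then zeroes all digits, whatever `pre` is. -/
theorem simRun_borrow_none (q₁ q₀ : M.State) (n : ℕ) (pre : List Bool)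
    (hL : pre.length + n ≤ L) :
    M.SimRun w L
      (M.simCfg (.borrow i q₁ q₀) p o T i (tapeOf (pre ++ List.replicate n false))
        (pre.length + 1))
      (M.simCfg (.ready q₀) p o T i (tapeOf (List.replicate (pre.length + n) false)) 1) := by
  induction n generalizing pre with
  | zero =>
    have h1 := M.simRun_single w p o T i (L := L) (s := .borrow i q₁ q₀)
      (s' := .back i true q₀) (X := tapeOf pre) (h := pre.length + 1) none .stay
      (by intro a t ht; rw [tapeOf_end] at ht; simp [simTrans, ht])
      (by simp [Transducer.moveWork]; omega)
    have h2 := M.simRun_single w p o T i (L := L) (s := .back i true q₀)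
      (s' := .back i true q₀) (X := tapeOf pre) (h := pre.length + 1) none .left
      (by intro a t ht; rw [tapeOf_end] at ht; simp [simTrans, ht])
      (by simp [Transducer.moveWork]; omega)
    rw [Function.update_eq_self_iff.2 (tapeOf_end pre).symm] at h1 h2
    have h3 := M.simRun_back_clear w p o T i (L := L) q₀ pre [] (by omega)
    simp only [List.replicate_zero, List.append_nil, add_zero] at h3 ⊢
    exact (h1.append h2).append h3
  | succ n ih =>
    have h1 := M.simRun_single w p o T i (L := L) (s := .borrow i q₁ q₀)
      (s' := .borrow i q₁ q₀) (X := tapeOf (pre ++ false :: List.replicate n false))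
      (h := pre.length + 1) (some (some true)) .right
      (by intro a t ht; rw [tapeOf_at] at ht; simp [simTrans, ht])
      (by simp [Transducer.moveWork]; omega)
    rw [update_tapeOf] at h1
    refine h1.append ?_
    have := ih (pre ++ [true]) (by simp; omega)
    simpa [Transducer.moveWork, add_assoc, add_comm 1 n] using this

end Walks

/-! ### Correctness of the simulation -/

/-- The configuration of the transducer that represents a configuration of the counter machine,
given the digits of the counters. -/
def repCfg (M : CounterMachine α β) (c : M.Cfg) (ds : Fin M.k → List Bool) :
    M.toTransducer.Cfg where
  state := .ready c.state
  inputPos := c.pos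
  tape := fun i => tapeOf (ds i)
  head := fun _ => 1
  output := c.output

theorem repCfg_eq_simCfg (M : CounterMachine α β) (c : M.Cfg) (ds : Fin M.k → List Bool)
    (i : Fin M.k) :
    M.repCfg c ds =
      M.simCfg (.ready c.state) c.pos c.output (fun i => tapeOf (ds i)) i (tapeOf (ds i)) 1 := by
  simp [repCfg, simCfg]

theorem simCfg_eq_repCfg (M : CounterMachine α β) (c : M.Cfg) (ds : Fin M.k → List Bool)
    (i : Fin M.k) (es : List Bool) :
    M.simCfg (.ready c.state) c.pos c.output (fun i => tapeOf (ds i)) i (tapeOf es) 1 =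
      M.repCfg c (Function.update ds i es) := by
  simp only [repCfg, simCfg, Function.update_eq_self, Transducer.Cfg.mk.injEq, true_and, and_true]
  funext j
  by_cases hj : j = i
  · subst hj; simp
  · simp [hj]

/-- Leading zeros make the digits of a counter non-unique, so the digit lists are carried along as
extra data constrained only by value and length. -/
theorem simRun_of_step (M : CounterMachine α β) (w : List α) {L N : ℕ} (hN : N < 2 ^ L)
    {c c' : M.Cfg} (hc : M.step w c = some c') (hb : ∀ i, c'.cnt i ≤ N)
    (ds : Fin M.k → List Bool) (hd : ∀ i, binVal (ds i) = c.cnt i)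
    (hl : ∀ i, (ds i).length ≤ L) :
    ∃ es : Fin M.k → List Bool, M.SimRun w L (M.repCfg c ds) (M.repCfg c' es) ∧
      (∀ i, binVal (es i) = c'.cnt i) ∧ ∀ i, (es i).length ≤ L := by
  unfold step at hc
  split at hc
  · rename_i g hg
    simp only [Option.map_eq_some_iff] at hc
    obtain ⟨r, hr, rfl⟩ := hc
    refine ⟨ds, Relation.ReflTransGen.single ⟨?_, fun i => by simp [repCfg]⟩, hd, hl⟩
    simp [Transducer.step, repCfg, simTrans, hg, hr, Transducer.moveWork]
  · rename_i i q hq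
    simp only [Option.some.injEq] at hc
    subst hc
    refine ⟨Function.update ds i (binInc (ds i)), ?_, ?_, ?_⟩
    · have h1 : M.SimRun w L (M.repCfg c ds) (M.simCfg (.carry i q) c.pos c.output
          (fun i => tapeOf (ds i)) i (tapeOf (ds i)) 1) := by
        refine Relation.ReflTransGen.single ⟨?_, fun i => by simp [simCfg]⟩
        simp [Transducer.step, repCfg, simCfg, simTrans, hq, Transducer.moveWork,
          Transducer.moveInput]
      -- If the list grows, the new counter value equals `2 ^ (ds i).length`; being at most `N < 2 ^
      -- L`, it leaves room for one more digit.
      have hlen : (binInc (ds i)).length ≤ L := by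
        rcases length_binInc (ds i) with h | ⟨h, h'⟩
        · rw [h]; exact hl i
        · have := hb i
          simp only [Function.update_self] at this
          rw [hd i] at h'
          have : (ds i).length < L := (Nat.pow_lt_pow_iff_right (a := 2) (by norm_num)).1 (by omega)
          omega
      refine h1.append ?_
      have h2 := M.simRun_carry w c.pos c.output (fun i => tapeOf (ds i)) i (L := L) q []
        (ds i) (by simpa using hlen)
      rw [← simCfg_eq_repCfg]
      exact h2
    · intro j
      by_cases hj : j = i
      · subst hj; simp [binVal_binInc, hd]
      · simp [hj, hd]
    · intro j
      by_cases hj : j = i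
      · subst hj
        simp only [Function.update_self]
        rcases length_binInc (ds j) with h | ⟨h, h'⟩
        · rw [h]; exact hl j
        · have := hb j
          simp only [Function.update_self] at this
          rw [hd j] at h'
          have : (ds j).length < L := (Nat.pow_lt_pow_iff_right (a := 2) (by norm_num)).1 (by omega)
          omega
      · simp [hj, hl]
  · rename_i i q₁ q₀ hq
    have h1 : M.SimRun w L (M.repCfg c ds) (M.simCfg (.borrow i q₁ q₀) c.pos c.output
        (fun i => tapeOf (ds i)) i (tapeOf (ds i)) 1) := by
      refine Relation.ReflTransGen.single ⟨?_, fun i => by simp [simCfg]⟩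
      simp [Transducer.step, repCfg, simCfg, simTrans, hq, Transducer.moveWork,
        Transducer.moveInput]
    rcases hdec : binDec (ds i) with _ | es
    · obtain ⟨h2, h3⟩ := binDec_eq_none hdec
      rw [hd] at h3
      rw [if_pos h3, Option.some.injEq] at hc
      subst hc
      refine ⟨ds, h1.append ?_, hd, hl⟩
      have h4 := M.simRun_borrow_none w c.pos c.output (fun i => tapeOf (ds i)) i (L := L) q₁ q₀
        (ds i).length [] (by simpa using hl i)
      simp only [List.nil_append, List.length_nil, zero_add, ← h2] at h4
      rwa [M.repCfg_eq_simCfg _ _ i]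
    · obtain ⟨h2, h3⟩ := binDec_eq_some hdec
      rw [hd] at h3
      rw [if_neg (by omega), Option.some.injEq] at hc
      subst hc
      refine ⟨Function.update ds i es, h1.append ?_, ?_, ?_⟩
      · rw [← simCfg_eq_repCfg]
        exact M.simRun_borrow_some w c.pos c.output (fun i => tapeOf (ds i)) i (L := L) q₁ q₀ []
          (ds i) es hdec (by simpa using hl i)
      · intro j
        by_cases hj : j = i
        · subst hj; simp; omega
        · simp [hj, hd]
      · intro j
        by_cases hj : j = i
        · subst hj; simp [h2, hl]
        · simp [hj, hl]

theorem simRun_of_run (M : CounterMachine α β) (w : List α) {L N : ℕ} (hN : N < 2 ^ L)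
    {c c' : M.Cfg} (hc : M.Run w N c c')
    (ds : Fin M.k → List Bool) (hd : ∀ i, binVal (ds i) = c.cnt i)
    (hl : ∀ i, (ds i).length ≤ L) :
    ∃ es : Fin M.k → List Bool, M.SimRun w L (M.repCfg c ds) (M.repCfg c' es) := by
  induction hc using Relation.ReflTransGen.head_induction_on generalizing ds with
  | refl => exact ⟨ds, .refl⟩
  | head h _ ih =>
    obtain ⟨es, h1, h2, h3⟩ := M.simRun_of_step w hN h.1 h.2 ds hd hl
    obtain ⟨fs, h4⟩ := ih es h2 h3
    exact ⟨fs, h1.append h4⟩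

/-- A deterministic run into a halting configuration visits every reachable configuration. -/
theorem _root_.Relation.ReflTransGen.inv_of_halting {σ : Type*} {step : σ → Option σ}
    {Inv : σ → Prop} {a z c : σ}
    (h : Relation.ReflTransGen (fun a b => step a = some b ∧ Inv b) a z) (hz : step z = none)
    (hc : Relation.ReflTransGen (fun a b => step a = some b) a c) (ha : Inv a) : Inv c := by
  induction h using Relation.ReflTransGen.head_induction_on with
  | refl =>
    rcases hc.cases_head with rfl | ⟨b, hb, -⟩
    · exact ha
    · rw [hz] at hb; cases hb
  | head h _ ih =>
    rcases hc.cases_head with rfl | ⟨b, hb, hbc⟩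
    · exact ha
    · rw [h.1, Option.some.injEq] at hb
      subst hb
      exact ih hbc h.2

/-- A function computed by a counter machine with linearly bounded counters is computable in
logarithmic space. -/
theorem logspaceComputable [Finite α] [Finite β] (M : CounterMachine α β) (K : ℕ)
    (f : List α → List β)
    (h : ∀ w, ∃ c, M.Run w (K * (w.length + 1)) M.init c ∧ M.step w c = none ∧ c.output = f w) :
    LogspaceComputable f := by
  -- This many digits suffice because `K < 2 ^ K` and `w.length < 2 ^ (Nat.log 2 w.length + 1)`.
  have key : ∀ w, ∃ c, M.SimRun w (K + Nat.log 2 w.length + 2) M.toTransducer.init c ∧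
      M.toTransducer.step w c = none ∧ c.output = f w := by
    intro w
    obtain ⟨c, h1, h2, h3⟩ := h w
    have hN : K * (w.length + 1) < 2 ^ (K + Nat.log 2 w.length + 2) := by
      have e1 : K < 2 ^ K := Nat.lt_two_pow_self
      have e2 : w.length < 2 ^ (Nat.log 2 w.length + 1) :=
        Nat.lt_pow_succ_log_self (by norm_num) _
      calc K * (w.length + 1) ≤ 2 ^ K * 2 ^ (Nat.log 2 w.length + 1) :=
            Nat.mul_le_mul e1.le e2
        _ = 2 ^ (K + Nat.log 2 w.length + 1) := by rw [← pow_add, add_assoc]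
        _ < _ := Nat.pow_lt_pow_right (by norm_num) (by omega)
    obtain ⟨es, h4⟩ := M.simRun_of_run w hN h1 (fun _ => []) (fun _ => rfl) (fun _ => by simp)
    refine ⟨M.repCfg c es, Relation.ReflTransGen.head ⟨?_, fun i => ?_⟩ h4, ?_, h3⟩
    · simp only [Transducer.step, Transducer.init, simTrans, repCfg, init, Option.map_some,
        Option.some.injEq, Transducer.Cfg.mk.injEq, true_and]
      refine ⟨rfl, ?_, rfl, rfl⟩
      funext i j
      rcases j with _ | j <;> simp [tapeOf]
    · simp [repCfg]
    · unfold step at h2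
      split at h2
      · rename_i g hg
        simp only [Option.map_eq_none_iff] at h2
        simp [Transducer.step, repCfg, simTrans, hg, h2]
      · cases h2
      · split at h2 <;> cases h2
  -- Heads stay at or below cell `K + Nat.log 2 w.length + 3`, which is less than `(K + 4) *
  -- (Nat.log 2 w.length + 1)`.
  refine ⟨M.toTransducer, fun w => ?_, K + 4, fun w c hc i => ?_⟩
  · obtain ⟨c, h1, h2, h3⟩ := key w
    exact ⟨c, Relation.ReflTransGen.mono (fun _ _ h => h.1) _ _ h1, h2, h3⟩
  · obtain ⟨z, h1, h2, -⟩ := key w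
    -- The space bound concerns every reachable configuration; by determinism each of them lies on
    -- the halting run.
    have := Relation.ReflTransGen.inv_of_halting h1 h2 hc (fun i => by simp [Transducer.init]) i
    nlinarith [Nat.zero_le (Nat.log 2 w.length), Nat.zero_le K]

end CounterMachine

/-! ## Scanning programs

A scanning program first checks its input with a finite automaton that has one counter of pending
items, and then translates the input letter by letter. The translation of a letter may refer to the
suffix of the input that is reached by skipping a given number of items, each letter `a` replacing
one pending item by `ar a` new ones. -/

/-- The instructions for the translation of a letter: emit an output letter; or skip `m` items after
the current letter and then emit the length of the remaining suffix in unary (`ref true m`) or the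
block of bits at the beginning of the remaining suffix (`ref false m`). -/
inductive ScanInstr (β : Type) (M : ℕ) : Type
  | emit : β → ScanInstr β M
  | ref : Bool → {m : ℕ // m ≤ M} → ScanInstr β M

instance (β : Type) (M : ℕ) [Finite β] : Finite (ScanInstr β M) :=
  haveI : Finite {m : ℕ // m ≤ M} := Set.finite_le_nat M
  Finite.of_injective
    (fun s : ScanInstr β M => (match s with
      | .emit b => Sum.inl b
      | .ref k m => Sum.inr (k, m) : β ⊕ (Bool × {m : ℕ // m ≤ M})))
    (by
      intro a b h
      cases a <;> cases b <;> simp_all)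

/-- A scanning program with input alphabet `α`, output alphabet `β`, modes `S` of the check, and
bounds `M` on the numbers of items and `N` on the lengths of translations. -/
structure ScanProgram (α β S : Type) (M N : ℕ) where
  ar : α → {m : ℕ // m ≤ M}
  startMode : S
  check : S → Bool → α → Option (S × {m : ℕ // m ≤ M})
  accept : S → Bool
  code : α → {l : List (ScanInstr β M) // l.length ≤ N}
  tick : β
  close : β
  bit : α → Option β
  bad : β
  final : List β
  length_final : final.length ≤ N

namespace ScanProgram

variable {α β S : Type} {M N : ℕ}

/-! ### Semantics -/

/-- The check of a suffix in mode `s` with `d` pending items. -/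
def accepts (P : ScanProgram α β S M N) : S → ℕ → List α → Bool
  | s, d, [] => P.accept s && d == 0
  | s, d, a :: u =>
    match P.check s (d != 0) a with
    | none => false
    | some (s', m) => P.accepts s' (d - 1 + m) u

/-- The suffix that remains after skipping `d` items. -/
def skip (ar : α → ℕ) : ℕ → List α → List α
  | 0, u => u
  | _ + 1, [] => []
  | d + 1, a :: u => skip ar (d + ar a) u

/-- The block of bits at the beginning of a word, terminated by `close`. -/
def copyBits (bit : α → Option β) (close : β) : List α → List β
  | [] => []
  | a :: u =>
    match bit a with
    | some b => b :: copyBits bit close u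
    | none => [close]

/-- The output at a suffix. -/
def reference (P : ScanProgram α β S M N) (k : Bool) (u : List α) : List β :=
  if k then List.replicate u.length P.tick ++ [P.close] else copyBits P.bit P.close u

/-- The output of an instruction executed at a letter followed by `u`. -/
def exec (P : ScanProgram α β S M N) (u : List α) : ScanInstr β M → List β
  | .emit b => [b]
  | .ref k m => P.reference k (skip (fun a => (P.ar a).1) m u)

/-- The translation of a word. -/
def translate (P : ScanProgram α β S M N) : List α → List β
  | [] => []
  | a :: u => (P.code a).1.flatMap (P.exec u) ++ P.translate u

/-- The function computed by a scanning program. -/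
def eval (P : ScanProgram α β S M N) (w : List α) : List β :=
  if P.accepts P.startMode 0 w then P.translate w ++ P.final else [P.bad]

/-! ### Implementation by a counter machine

Counter `0` holds the offset from the letter that is being translated, counter `1` the number of
pending items. -/

/-- Lists of instructions of length at most `N`. -/
abbrev Code (β : Type) (M N : ℕ) : Type := {l : List (ScanInstr β M) // l.length ≤ N}

/-- The states of the counter machine. -/
inductive State (β S : Type) (M N : ℕ) : Type
  | first : State β S M N
  | chk : S → State β S M N
  | chkRead : S → Bool → State β S M N
  | chkAdd : S → {m : ℕ // m ≤ M} → State β S M N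
  | bad : State β S M N
  | halt : State β S M N
  | rewind : State β S M N
  | main : State β S M N
  | run : Code β M N → State β S M N
  | advance : Bool → Code β M N → {m : ℕ // m ≤ M} → State β S M N
  | add : Bool → Code β M N → {m : ℕ // m ≤ M} → State β S M N
  | skip : Bool → Code β M N → State β S M N
  | skipRead : Bool → Code β M N → State β S M N
  | out : Bool → Code β M N → State β S M N
  | outAdvance : Bool → Code β M N → State β S M N
  | back : Code β M N → State β S M N
  | backMove : Code β M N → State β S M N

instance [Finite β] [Finite S] : Finite (State β S M N) :=
  haveI : Finite {m : ℕ // m ≤ M} := Set.finite_le_nat M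
  haveI : Finite (Code β M N) := List.finite_length_le _ _
  Finite.of_injective
    (fun s : State β S M N => (match s with
      | .first => (0, none, none, none, none)
      | .chk s => (1, some s, none, none, none)
      | .chkRead s b => (2, some s, some b, none, none)
      | .chkAdd s m => (3, some s, none, none, some m)
      | .bad => (4, none, none, none, none)
      | .halt => (5, none, none, none, none)
      | .rewind => (6, none, none, none, none)
      | .main => (7, none, none, none, none)
      | .run l => (8, none, none, some l, none)
      | .advance k l m => (9, none, some k, some l, some m)
      | .add k l m => (10, none, some k, some l, some m)
      | .skip k l => (11, none, some k, some l, none)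
      | .skipRead k l => (12, none, some k, some l, none)
      | .out k l => (13, none, some k, some l, none)
      | .outAdvance k l => (14, none, some k, some l, none)
      | .back l => (15, none, none, some l, none)
      | .backMove l => (16, none, none, some l, none) :
      Fin 17 × Option S × Option Bool × Option (Code β M N) × Option {m : ℕ // m ≤ M}))
    (by
      intro a b h
      cases a <;> cases b <;> simp_all)

/-- The instruction of the counter machine in a given state. -/
def prog (P : ScanProgram α β S M N) : State β S M N → CounterInstr α β (State β S M N) 2
  | .first => .read fun _ => some (.chk P.startMode, .right, none)
  | .chk s => .dec 1 (.chkRead s true) (.chkRead s false)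
  | .chkRead s nz => .read fun c =>
    match c with
    | .leftEnd => none
    | .letter a =>
      match P.check s nz a with
      | none => some (.bad, .stay, none)
      | some (s', m) => some (.chkAdd s' m, .right, none)
    | .rightEnd =>
      if P.accept s && !nz then some (.rewind, .stay, none) else some (.bad, .stay, none)
  | .chkAdd s ⟨0, _⟩ => .read fun _ => some (.chk s, .stay, none)
  | .chkAdd s ⟨m + 1, h⟩ => .inc 1 (.chkAdd s ⟨m, Nat.le_of_succ_le h⟩)
  | .bad => .read fun _ => some (.halt, .stay, some P.bad)
  | .halt => .read fun _ => none
  | .rewind => .read fun c =>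
    match c with
    | .leftEnd => some (.main, .right, none)
    | _ => some (.rewind, .left, none)
  | .main => .read fun c =>
    match c with
    | .leftEnd => none
    | .letter a => some (.run (P.code a), .stay, none)
    | .rightEnd => some (.run ⟨P.final.map .emit, by simpa using P.length_final⟩, .stay, none)
  | .run ⟨[], _⟩ => .read fun c =>
    match c with
    | .letter _ => some (.main, .right, none)
    | _ => none
  | .run ⟨.emit b :: l, h⟩ =>
    .read fun _ => some (.run ⟨l, Nat.le_of_succ_le h⟩, .stay, some b)
  | .run ⟨.ref k m :: l, h⟩ =>
    .read fun _ => some (.advance k ⟨l, Nat.le_of_succ_le h⟩ m, .right, none)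
  | .advance k l m => .inc 0 (.add k l m)
  | .add k l ⟨0, _⟩ => .read fun _ => some (.skip k l, .stay, none)
  | .add k l ⟨m + 1, h⟩ => .inc 1 (.add k l ⟨m, Nat.le_of_succ_le h⟩)
  | .skip k l => .dec 1 (.skipRead k l) (.out k l)
  | .skipRead k l => .read fun c =>
    match c with
    | .leftEnd => none
    | .letter a => some (.advance k l (P.ar a), .right, none)
    | .rightEnd => some (.skip k l, .stay, none)
  | .out k l => .read fun c =>
    match c with
    | .leftEnd => none
    | .letter a =>
      if k then some (.outAdvance k l, .right, some P.tick) else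
        match P.bit a with
        | some b => some (.outAdvance k l, .right, some b)
        | none => some (.back l, .stay, some P.close)
    | .rightEnd => some (.back l, .stay, if k then some P.close else none)
  | .outAdvance k l => .inc 0 (.out k l)
  | .back l => .dec 0 (.backMove l) (.run l)
  | .backMove l => .read fun _ => some (.back l, .left, none)

/-- The counter machine that executes a scanning program. -/
abbrev machine [Finite β] [Finite S] (P : ScanProgram α β S M N) : CounterMachine α β where
  State := State β S M N
  finState := inferInstance
  k := 2
  start := .first
  prog := P.prog

/-! ### Runs of the counter machine of a scanning program. -/

section Machine

variable [Finite β] [Finite S] (P : ScanProgram α β S M N) (w : List α) {B : ℕ}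

/-- The configuration with offset `x` and `d` pending items. -/
def cfg (q : State β S M N) (p x d : ℕ) (o : List β) : P.machine.Cfg := ⟨q, p, ![x, d], o⟩

theorem run_of_step {q q' : State β S M N} {p p' x x' d d' : ℕ} {o o' : List β}
    (h : P.machine.step w (P.cfg q p x d o) = some (P.cfg q' p' x' d' o')) (hx : x' ≤ B)
    (hd : d' ≤ B) : P.machine.Run w B (P.cfg q p x d o) (P.cfg q' p' x' d' o') :=
  Relation.ReflTransGen.single ⟨h, by intro i; fin_cases i <;> simpa [cfg]⟩

theorem run_read {q q' : State β S M N} {g} {p x d : ℕ} {o : List β} {m : HeadMove}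
    {b : Option β} (hq : P.prog q = .read g)
    (hg : g (Transducer.readInput w p) = some (q', m, b)) (hx : x ≤ B) (hd : d ≤ B) :
    P.machine.Run w B (P.cfg q p x d o)
      (P.cfg q' (Transducer.moveInput w m p) x d (o ++ b.toList)) :=
  P.run_of_step w (by simp [CounterMachine.step, cfg, hq, hg]) hx hd

theorem run_inc_offset {q q' : State β S M N} {p x d : ℕ} {o : List β}
    (hq : P.prog q = .inc 0 q') (hx : x + 1 ≤ B) (hd : d ≤ B) :
    P.machine.Run w B (P.cfg q p x d o) (P.cfg q' p (x + 1) d o) :=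
  P.run_of_step w (by
    simp only [CounterMachine.step, cfg, hq, Option.some.injEq, CounterMachine.Cfg.mk.injEq,
      true_and, and_true]
    funext i; fin_cases i <;> simp) hx hd

theorem run_inc_pending {q q' : State β S M N} {p x d : ℕ} {o : List β}
    (hq : P.prog q = .inc 1 q') (hx : x ≤ B) (hd : d + 1 ≤ B) :
    P.machine.Run w B (P.cfg q p x d o) (P.cfg q' p x (d + 1) o) :=
  P.run_of_step w (by
    simp only [CounterMachine.step, cfg, hq, Option.some.injEq, CounterMachine.Cfg.mk.injEq,
      true_and, and_true]
    funext i; fin_cases i <;> simp) hx hd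

theorem run_dec_offset {q q₁ q₀ : State β S M N} {p x d : ℕ} {o : List β}
    (hq : P.prog q = .dec 0 q₁ q₀) (hx : x ≤ B) (hd : d ≤ B) :
    P.machine.Run w B (P.cfg q p x d o) (P.cfg (if x = 0 then q₀ else q₁) p (x - 1) d o) := by
  refine P.run_of_step w ?_ (by omega) hd
  rcases x with _ | x
  · simp [CounterMachine.step, cfg, hq]
  · simp only [CounterMachine.step, cfg, hq]
    simp only [Matrix.cons_val_zero, Nat.add_eq_zero_iff, one_ne_zero, and_false, if_false,
      Option.some.injEq, CounterMachine.Cfg.mk.injEq, true_and, and_true]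
    funext i; fin_cases i <;> simp

theorem run_dec_pending {q q₁ q₀ : State β S M N} {p x d : ℕ} {o : List β}
    (hq : P.prog q = .dec 1 q₁ q₀) (hx : x ≤ B) (hd : d ≤ B) :
    P.machine.Run w B (P.cfg q p x d o) (P.cfg (if d = 0 then q₀ else q₁) p x (d - 1) o) := by
  refine P.run_of_step w ?_ hx (by omega)
  rcases d with _ | d
  · simp [CounterMachine.step, cfg, hq]
  · simp only [CounterMachine.step, cfg, hq]
    simp only [Matrix.cons_val_one, Matrix.cons_val_fin_one, Nat.add_eq_zero_iff, one_ne_zero,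
      and_false, if_false, Option.some.injEq, CounterMachine.Cfg.mk.injEq, true_and, and_true]
    funext i; fin_cases i <;> rfl

theorem _root_.Transducer.readInput_append_cons (pre : List α) (a : α) (u : List α) :
    Transducer.readInput (pre ++ a :: u) (pre.length + 1) = .letter a := by
  simp [Transducer.readInput]

theorem _root_.Transducer.moveInput_stay (w : List α) (p : ℕ) :
    Transducer.moveInput w .stay p = p := rfl

theorem _root_.Transducer.readInput_end (w : List α) :
    Transducer.readInput w (w.length + 1) = .rightEnd := by
  simp [Transducer.readInput]

theorem _root_.Transducer.moveInput_append_cons (pre : List α) (a : α) (u : List α) :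
    Transducer.moveInput (pre ++ a :: u) .right (pre.length + 1) = pre.length + 1 + 1 := by
  simp [Transducer.moveInput]

theorem run_chkAdd (s : S) (m : ℕ) (hm : m ≤ M) (p d : ℕ) (o : List β) (hd : d + m ≤ B) :
    P.machine.Run w B (P.cfg (.chkAdd s ⟨m, hm⟩) p 0 d o) (P.cfg (.chk s) p 0 (d + m) o) := by
  induction m generalizing d with
  | zero =>
    simpa [Transducer.moveInput_stay] using P.run_read w (o := o) (x := 0) (p := p) (d := d)
      (B := B)
      (q := .chkAdd s ⟨0, hm⟩) rfl rfl (by omega) (by omega)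
  | succ m ih =>
    refine (P.run_inc_pending w rfl (by omega) (by omega)).append ?_
    have := ih (by omega) (d + 1) (by omega)
    rwa [show d + 1 + m = d + (m + 1) by omega] at this

/-- The quantity `d + M * u.length` never increases: each letter read uses up `M` of it and adds at
most `M` pending items. Hence one bound `B` serves the whole check. -/
theorem run_chk (s : S) (d : ℕ) (pre u : List α) (hw : w = pre ++ u) (o : List β)
    (hB : d + M * u.length ≤ B) :
    if P.accepts s d u then
      P.machine.Run w B (P.cfg (.chk s) (pre.length + 1) 0 d o)
        (P.cfg .rewind (w.length + 1) 0 0 o)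
    else ∃ p d', d' ≤ B ∧ P.machine.Run w B (P.cfg (.chk s) (pre.length + 1) 0 d o)
      (P.cfg .bad p 0 d' o) := by
  induction u generalizing s d pre with
  | nil =>
    rw [List.append_nil] at hw
    subst hw
    have h1 := P.run_dec_pending w (q := .chk s) (p := w.length + 1) (o := o) (B := B) (x := 0)
      (d := d) rfl (by omega) (by omega)
    by_cases hd : d = 0
    · subst hd
      simp only [if_true] at h1
      by_cases ha : P.accept s = true
      · simp only [accepts, ha, beq_self_eq_true, Bool.and_self, if_true]
        refine h1.append ?_
        simpa [Transducer.moveInput] using P.run_read w (o := o) (x := 0) (p := w.length + 1)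
          (d := 0) (B := B) (q := .chkRead s false) (q' := .rewind) (m := .stay) (b := none) rfl
          (by simp [Transducer.readInput_end, ha]) (by omega) (by omega)
      · simp only [accepts, ha, Bool.false_and, Bool.false_eq_true, if_false]
        refine ⟨w.length + 1, 0, by omega, h1.append ?_⟩
        simpa [Transducer.moveInput] using P.run_read w (o := o) (x := 0) (p := w.length + 1)
          (d := 0) (B := B) (q := .chkRead s false) (q' := .bad) (m := .stay) (b := none) rfl
          (by simp [Transducer.readInput_end, ha]) (by omega) (by omega)
    · simp only [if_neg hd] at h1
      rw [if_neg (by simp [accepts, hd])]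
      refine ⟨w.length + 1, d - 1, by omega, h1.append ?_⟩
      simpa [Transducer.moveInput] using P.run_read w (o := o) (x := 0) (p := w.length + 1)
        (d := d - 1) (B := B) (q := .chkRead s true) (q' := .bad) (m := .stay) (b := none) rfl
        (by simp [Transducer.readInput_end]) (by omega) (by omega)
  | cons a u ih =>
    subst hw
    simp only [List.length_cons, mul_add, mul_one] at hB
    have h1 := P.run_dec_pending (pre ++ a :: u) (q := .chk s) (p := pre.length + 1) (o := o)
      (B := B) (x := 0) (d := d) rfl (by omega) (by omega)
    rw [show (if d = 0 then State.chkRead (β := β) (M := M) (N := N) s false else .chkRead s true) =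
      .chkRead s (d != 0) by split <;> simp_all] at h1
    rcases hc : P.check s (d != 0) a with _ | ⟨s', m, hm⟩
    · rw [if_neg (by simp [accepts, hc])]
      refine ⟨pre.length + 1, d - 1, by omega, h1.append ?_⟩
      simpa [Transducer.moveInput] using P.run_read (pre ++ a :: u) (o := o) (x := 0)
        (p := pre.length + 1)
        (d := d - 1) (B := B) (q := .chkRead s (d != 0)) (q' := .bad) (m := .stay) (b := none) rfl
        (by simp [Transducer.readInput_append_cons, hc]) (by omega) (by omega)
    · have h2 := P.run_read (pre ++ a :: u) (o := o) (x := 0)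
        (p := pre.length + 1) (d := d - 1) (B := B) (q := .chkRead s (d != 0))
        (q' := .chkAdd s' ⟨m, hm⟩) (m := .right) (b := none) rfl
        (by simp [Transducer.readInput_append_cons, hc]) (by omega) (by omega)
      simp only [Transducer.moveInput_append_cons, Option.toList_none, List.append_nil] at h2
      have h3 := P.run_chkAdd (pre ++ a :: u) s' m hm (pre.length + 1 + 1) (d - 1) o (B := B)
        (by omega)
      have h4 := ih s' (d - 1 + m) (pre ++ [a]) (by simp) (by omega)
      have e : P.accepts s d (a :: u) = P.accepts s' (d - 1 + m) u := by simp [accepts, hc]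
      rw [e]
      simp only [List.length_append, List.length_singleton] at h4
      split at h4
      · rw [if_pos ‹_›]
        exact h1.append (h2.append (h3.append (by simpa using h4)))
      · rw [if_neg ‹_›]
        obtain ⟨p, d', hd', h5⟩ := h4
        exact ⟨p, d', hd', h1.append (h2.append (h3.trans h5))⟩

theorem run_rewind (p : ℕ) (o : List β) :
    P.machine.Run w B (P.cfg .rewind p 0 0 o) (P.cfg .main 1 0 0 o) := by
  induction p with
  | zero =>
    simpa [Transducer.moveInput] using P.run_read w (o := o) (x := 0) (p := 0)
      (d := 0) (B := B) (q := .rewind) (q' := .main) (m := .right) (b := none) rfl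
      (by simp [Transducer.readInput]) (by omega) (by omega)
  | succ p ih =>
    refine CounterMachine.Run.append ?_ ih
    simpa [Transducer.moveInput] using P.run_read w (o := o) (x := 0) (p := p + 1)
      (d := 0) (B := B) (q := .rewind) (q' := .rewind) (m := .left) (b := none) rfl
      (by cases h : w[p]? <;> simp [Transducer.readInput, h])
      (by omega) (by omega)

theorem run_add (k : Bool) (l : Code β M N) (m : ℕ) (hm : m ≤ M) (p x d : ℕ) (o : List β)
    (hx : x ≤ B) (hd : d + m ≤ B) :
    P.machine.Run w B (P.cfg (.add k l ⟨m, hm⟩) p x d o) (P.cfg (.skip k l) p x (d + m) o) := by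
  induction m generalizing d with
  | zero =>
    simpa [Transducer.moveInput_stay] using P.run_read w (o := o) (x := x) (p := p) (d := d)
      (B := B)
      (q := .add k l ⟨0, hm⟩) rfl rfl (by omega) (by omega)
  | succ m ih =>
    refine (P.run_inc_pending w rfl (by omega) (by omega)).append ?_
    have := ih (by omega) (d + 1) (by omega)
    rwa [show d + 1 + m = d + (m + 1) by omega] at this

theorem run_advance (k : Bool) (l : Code β M N) (m : {m : ℕ // m ≤ M}) (p x d : ℕ) (o : List β)
    (hx : x + 1 ≤ B) (hd : d + m ≤ B) :
    P.machine.Run w B (P.cfg (.advance k l m) p x d o) (P.cfg (.skip k l) p (x + 1) (d + m) o) :=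
  (P.run_inc_offset w rfl hx (by omega)).append (P.run_add w k l m.1 m.2 p (x + 1) d o hx hd)

/-- The equation between lengths and offsets says that the offset counter grows exactly with the
head position, which later allows the return to the letter being translated. -/
theorem run_skip (k : Bool) (l : Code β M N) (o : List β) (d : ℕ) (pre u : List α) (x : ℕ)
    (hw : w = pre ++ u) (hx : x ≤ pre.length) (hB : w.length ≤ B) (hd : d + M * u.length ≤ B) :
    ∃ pre' x', w = pre' ++ skip (fun a => (P.ar a).1) d u ∧ pre'.length + x = pre.length + x' ∧
      P.machine.Run w B (P.cfg (.skip k l) (pre.length + 1) x d o)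
        (P.cfg (.out k l) (pre'.length + 1) x' 0 o) := by
  have hxB : x ≤ B := by subst hw; simp at hB; omega
  have hz : P.machine.Run w B (P.cfg (.skip k l) (pre.length + 1) x 0 o)
        (P.cfg (.out k l) (pre.length + 1) x 0 o) := by
    simpa using P.run_dec_pending w (q := .skip k l) (p := pre.length + 1) (o := o)
      (B := B) (x := x) (d := 0) rfl hxB (by omega)
  induction u generalizing d pre x with
  | nil =>
    refine ⟨pre, x, by cases d <;> simpa [skip] using hw, rfl, ?_⟩
    rw [List.append_nil] at hw
    subst hw
    -- At the right end marker the head stays put and the pending items are discarded one at a time,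
    -- as `skip` does on the empty word.
    induction d with
    | zero => exact hz
    | succ d ih =>
      simp only [List.length_nil, mul_zero, add_zero] at hd ih
      have h1 := P.run_dec_pending w (q := .skip k l) (p := w.length + 1) (o := o)
        (B := B) (x := x) (d := d + 1) rfl hxB (by omega)
      have h2 := P.run_read w (o := o) (x := x) (p := w.length + 1)
        (d := d) (B := B) (q := .skipRead k l) (q' := .skip k l) (m := .stay) (b := none) rfl
        (by simp [Transducer.readInput_end]) (by omega) (by omega)
      simp only [Transducer.moveInput, Option.toList_none, List.append_nil] at h2
      simp only [Nat.add_eq_zero_iff, one_ne_zero, and_false, if_false, Nat.add_sub_cancel] at h1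
      exact h1.append (h2.append (ih (by omega)))
  | cons a u ih =>
    rcases d with _ | d
    · exact ⟨pre, x, by simpa [skip] using hw, rfl, hz⟩
    subst hw
    simp only [List.length_cons, mul_add, mul_one, List.length_append] at hd hB
    have hm := (P.ar a).2
    have h1 := P.run_dec_pending (pre ++ a :: u) (q := .skip k l) (p := pre.length + 1) (o := o)
      (B := B) (x := x) (d := d + 1) rfl hxB (by omega)
    have h2 := P.run_read (pre ++ a :: u) (o := o) (x := x) (p := pre.length + 1)
      (d := d) (B := B) (q := .skipRead k l) (q' := .advance k l (P.ar a)) (m := .right)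
      (b := none) rfl (by simp [Transducer.readInput_append_cons]) (by omega) (by omega)
    simp only [Transducer.moveInput_append_cons, Option.toList_none, List.append_nil] at h2
    simp only [Nat.add_eq_zero_iff, one_ne_zero, and_false, if_false, Nat.add_sub_cancel] at h1
    have h3 := P.run_advance (pre ++ a :: u) k l (P.ar a) (pre.length + 1 + 1) x d o (B := B)
      (by omega) (by omega)
    have hz' : P.machine.Run (pre ++ a :: u) B
        (P.cfg (.skip k l) ((pre ++ [a]).length + 1) (x + 1) 0 o)
        (P.cfg (.out k l) ((pre ++ [a]).length + 1) (x + 1) 0 o) := by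
      simpa using P.run_dec_pending (pre ++ a :: u) (q := .skip k l) (p := pre.length + 1 + 1)
        (o := o) (B := B) (x := x + 1) (d := 0) rfl (by omega) (by omega)
    obtain ⟨pre', x', e1, e2, h4⟩ := ih (d + P.ar a) (pre ++ [a]) (x + 1) (by simp)
      (by simpa using hx) (by omega) (by omega) hz'
    refine ⟨pre', x', by rw [e1]; rfl, by simp at e2; omega, h1.append (h2.append (h3.append ?_))⟩
    simpa using h4

/-- Copying bits stops at the first letter that is not a bit, so the distance `j` travelled is only
bounded; what matters is that head and offset advance by the same amount. -/
theorem run_out (k : Bool) (l : Code β M N) (o : List β) (pre u : List α) (x : ℕ)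
    (hw : w = pre ++ u) (hx : x ≤ pre.length) (hB : w.length ≤ B) :
    ∃ j, j ≤ u.length ∧ P.machine.Run w B (P.cfg (.out k l) (pre.length + 1) x 0 o)
        (P.cfg (.back l) (pre.length + 1 + j) (x + j) 0 (o ++ P.reference k u)) := by
  induction u generalizing o pre x with
  | nil =>
    refine ⟨0, le_rfl, ?_⟩
    rw [List.append_nil] at hw
    subst hw
    have h2 := P.run_read w (o := o) (x := x) (p := w.length + 1)
      (d := 0) (B := B) (q := .out k l) (q' := .back l) (m := .stay)
      (b := if k then some P.close else none) rfl
      (by simp [Transducer.readInput_end]) (by omega) (by omega)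
    rw [show P.reference k [] = (if k then some P.close else none).toList by
      cases k <;> simp [reference, copyBits]]
    exact h2
  | cons a u ih =>
    subst hw
    simp only [List.length_cons, List.length_append] at hB
    have go : ∀ b : β, P.reference k (a :: u) = b :: P.reference k u →
        P.machine.Run (pre ++ a :: u) B (P.cfg (.out k l) (pre.length + 1) x 0 o)
          (P.cfg (.outAdvance k l)
            (Transducer.moveInput (pre ++ a :: u) .right (pre.length + 1)) x 0 (o ++ [b])) →
        ∃ j, j ≤ (a :: u).length ∧
          P.machine.Run (pre ++ a :: u) B (P.cfg (.out k l) (pre.length + 1) x 0 o)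
          (P.cfg (.back l) (pre.length + 1 + j) (x + j) 0 (o ++ P.reference k (a :: u))) := by
      intro b hb h1
      rw [Transducer.moveInput_append_cons] at h1
      have h2 := P.run_inc_offset (pre ++ a :: u) (q := .outAdvance k l) (q' := .out k l) (B := B)
        (p := pre.length + 1 + 1) (o := o ++ [b]) (x := x) (d := 0) rfl (by omega) (by omega)
      obtain ⟨j, hj, h3⟩ := ih (o ++ [b]) (pre ++ [a]) (x + 1) (by simp) (by simpa using hx)
        
      refine ⟨j + 1, by simpa using hj, h1.append (h2.append ?_)⟩
      simp only [List.length_append, List.length_singleton] at h3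
      rw [hb, show o ++ b :: P.reference k u = o ++ [b] ++ P.reference k u by simp,
        show pre.length + 1 + (j + 1) = pre.length + 1 + 1 + j by omega,
        show x + (j + 1) = x + 1 + j by omega]
      exact h3
    cases k
    · rcases hb : P.bit a with _ | b
      · refine ⟨0, by simp, ?_⟩
        have h2 := P.run_read (pre ++ a :: u) (o := o) (x := x) (p := pre.length + 1)
          (d := 0) (B := B) (q := .out false l) (q' := .back l) (m := .stay)
          (b := some P.close) rfl
          (by simp [Transducer.readInput_append_cons, hb]) (by omega) (by omega)
        simpa [reference, copyBits, hb, Transducer.moveInput_stay] using h2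
      · refine go b (by simp [reference, copyBits, hb]) ?_
        exact P.run_read (pre ++ a :: u) (o := o) (x := x) (p := pre.length + 1)
          (d := 0) (B := B) (q := .out false l) (q' := .outAdvance false l) (m := .right)
          (b := some b) rfl
          (by simp [Transducer.readInput_append_cons, hb]) (by omega) (by omega)
    · refine go P.tick (by simp [reference, List.replicate_succ]) ?_
      exact P.run_read (pre ++ a :: u) (o := o) (x := x) (p := pre.length + 1)
        (d := 0) (B := B) (q := .out true l) (q' := .outAdvance true l) (m := .right)
        (b := some P.tick) rfl
        (by simp [Transducer.readInput_append_cons]) (by omega) (by omega)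

theorem run_back (l : Code β M N) (o : List β) (p x : ℕ) (hx : x ≤ B) :
    P.machine.Run w B (P.cfg (.back l) (p + x) x 0 o) (P.cfg (.run l) p 0 0 o) := by
  induction x with
  | zero =>
    simpa using P.run_dec_offset w (q := .back l) (p := p) (o := o) (B := B) (x := 0) (d := 0) rfl
      (by omega) (by omega)
  | succ x ih =>
    have h1 := P.run_dec_offset w (q := .back l) (p := p + (x + 1)) (o := o) (B := B) (x := x + 1)
      (d := 0) rfl (by omega) (by omega)
    have h2 := P.run_read w (o := o) (x := x) (p := p + (x + 1))
      (d := 0) (B := B) (q := .backMove l) (q' := .back l) (m := .left)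
      (b := none) rfl rfl (by omega) (by omega)
    simp only [Transducer.moveInput, Option.toList_none, List.append_nil] at h2
    simp only [Nat.add_eq_zero_iff, one_ne_zero, and_false, if_false, Nat.add_sub_cancel] at h1
    exact h1.append (h2.append (ih (by omega)))

theorem run_code (pre u : List α) (a : α) (hw : w = pre ++ a :: u)
    (hB : (M + 1) * (w.length + 1) ≤ B) (l : List (ScanInstr β M)) (hl : l.length ≤ N)
    (o : List β) :
    P.machine.Run w B (P.cfg (.run ⟨l, hl⟩) (pre.length + 1) 0 0 o)
      (P.cfg .main (pre.length + 1 + 1) 0 0 (o ++ l.flatMap (P.exec u))) := by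
  have hlen : w.length = pre.length + u.length + 1 := by simp [hw]; omega
  -- The bound is expanded so that the remaining inequalities are linear once products with `M` are
  -- treated as atoms.
  have hB' : M * (pre.length + u.length + 1) + M + (pre.length + u.length + 1) + 1 ≤ B := by
    rw [hlen] at hB; nlinarith
  have hM : M * u.length ≤ M * (pre.length + u.length + 1) := Nat.mul_le_mul_left _ (by omega)
  induction l generalizing o with
  | nil =>
    subst hw
    have h2 := P.run_read (pre ++ a :: u) (o := o) (x := 0) (p := pre.length + 1)
      (d := 0) (B := B) (q := .run ⟨[], hl⟩) (q' := .main) (m := .right)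
      (b := none) rfl
      (by simp [Transducer.readInput_append_cons]) (by omega) (by omega)
    rw [Transducer.moveInput_append_cons] at h2
    simpa using h2
  | cons i l ih =>
    rcases i with b | ⟨k, m⟩
    · have h2 := P.run_read w (o := o) (x := 0) (p := pre.length + 1)
        (d := 0) (B := B) (q := .run ⟨.emit b :: l, hl⟩) (m := .stay)
        (b := some b) rfl rfl (by omega) (by omega)
      refine h2.append ?_
      simpa [exec, Transducer.moveInput] using ih (Nat.le_of_succ_le hl) (o ++ [b])
    · have hm := m.2
      have hl' : l.length ≤ N := Nat.le_of_succ_le hl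
      have h2 := P.run_read w (o := o) (x := 0) (p := pre.length + 1)
        (d := 0) (B := B) (q := .run ⟨.ref k m :: l, hl⟩) (m := .right)
        (b := none) rfl rfl (by omega) (by omega)
      rw [hw, Transducer.moveInput_append_cons, ← hw, Option.toList_none, List.append_nil] at h2
      have h3 := P.run_advance w k ⟨l, hl'⟩ m (pre.length + 1 + 1) 0 0 o (B := B)
        (by omega) (by omega)
      -- The offset starts at `1`, because the head has already moved past the letter `a`.
      obtain ⟨pre', x', e1, e2, h4⟩ := P.run_skip w k ⟨l, hl'⟩ o m (pre ++ [a]) u 1 (B := B)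
        (by simp [hw]) (by simp) (by omega) (by omega)
      simp only [List.length_append, List.length_singleton] at e2
      have hp : pre'.length ≤ w.length := by rw [e1]; simp
      obtain ⟨j, hj, h5⟩ := P.run_out w k ⟨l, hl'⟩ o pre' _ x' (B := B) e1 (by omega) (by omega)
      have hpj : pre'.length + j ≤ w.length := by
        have := congrArg List.length e1
        rw [List.length_append] at this
        omega
      have h6 := P.run_back w ⟨l, hl'⟩ (o ++ P.reference k (skip (fun a => (P.ar a).1) m u))
        (pre.length + 1) (x' + j) (B := B) (by omega)
      have h7 := ih hl' (o ++ P.reference k (skip (fun a => (P.ar a).1) m u))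
      rw [show pre.length + 1 + (x' + j) = pre'.length + 1 + j by omega] at h6
      have h8 := h2.append (h3.append (CounterMachine.Run.append (by simpa using h4)
        (h5.append (h6.trans h7))))
      simpa [exec] using h8

theorem run_emit (p : ℕ) (l : List β) (hl : (l.map ScanInstr.emit).length ≤ N) (o : List β) :
    P.machine.Run w B (P.cfg (.run ⟨l.map .emit, hl⟩) p 0 0 o)
      (P.cfg (.run ⟨[], by simp⟩) p 0 0 (o ++ l)) := by
  induction l generalizing o with
  | nil => rw [List.append_nil]; exact Relation.ReflTransGen.refl
  | cons b l ih =>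
    have h2 := P.run_read w (o := o) (x := 0) (p := p)
      (d := 0) (B := B) (q := .run ⟨(b :: l).map .emit, hl⟩) (m := .stay)
      (b := some b) rfl rfl (by omega) (by omega)
    refine h2.append ?_
    simpa [Transducer.moveInput] using ih (Nat.le_of_succ_le hl) (o ++ [b])

/-- The final word is emitted by the same `run` states. With an empty list they move on after a
letter but halt at the right end marker. -/
theorem run_main (pre u : List α) (hw : w = pre ++ u) (hB : (M + 1) * (w.length + 1) ≤ B)
    (o : List β) :
    P.machine.Run w B (P.cfg .main (pre.length + 1) 0 0 o)
      (P.cfg (.run ⟨[], by simp⟩) (w.length + 1) 0 0 (o ++ P.translate u ++ P.final)) := by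
  induction u generalizing pre o with
  | nil =>
    rw [List.append_nil] at hw
    subst hw
    have h1 := P.run_read w (o := o) (x := 0) (p := w.length + 1)
      (d := 0) (B := B) (q := .main)
      (q' := .run ⟨P.final.map .emit, by simpa using P.length_final⟩) (m := .stay)
      (b := none) rfl
      (by simp [Transducer.readInput_end]) (by omega) (by omega)
    simp only [Transducer.moveInput, Option.toList_none, List.append_nil] at h1
    simpa [translate] using h1.append (P.run_emit w _ _ _ o)
  | cons a u ih =>
    have h1 := P.run_read w (o := o) (x := 0) (p := pre.length + 1)
      (d := 0) (B := B) (q := .main) (q' := .run (P.code a)) (m := .stay)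
      (b := none) rfl
      (by simp [hw, Transducer.readInput_append_cons]) (by omega) (by omega)
    simp only [Transducer.moveInput, Option.toList_none, List.append_nil] at h1
    have h2 := P.run_code w pre u a hw hB (P.code a).1 (P.code a).2 o
    have h3 := ih (pre ++ [a]) (by simp [hw]) (o ++ (P.code a).1.flatMap (P.exec u))
    simp only [List.length_append, List.length_singleton] at h3
    have h4 := h1.append (h2.trans h3)
    simpa [translate] using h4

/-- The offset counts head moves within the word, and each scanned letter adds at most `M` pending
items, so both counters are at most `(M + 1) * (w.length + 1)`. -/
theorem logspaceComputable_eval [Finite α] : LogspaceComputable P.eval := by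
  refine P.machine.logspaceComputable (M + 1) P.eval fun w => ?_
  set B := (M + 1) * (w.length + 1)
  have hB : M * w.length ≤ B := Nat.mul_le_mul (by omega) (by omega)
  have e : P.machine.init = P.cfg .first 0 0 0 [] := by
    simp only [CounterMachine.init, cfg, CounterMachine.Cfg.mk.injEq, true_and, and_true]
    funext i; fin_cases i <;> rfl
  have h1 := P.run_read w (o := []) (x := 0) (p := 0)
    (d := 0) (B := B) (q := .first) (m := .right) (b := none) rfl rfl (by omega) (by omega)
  have h2 := P.run_chk w P.startMode 0 [] w rfl [] (B := B) (by omega)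
  simp only [Transducer.moveInput, Option.toList_none, List.append_nil, zero_add,
    le_add_iff_nonneg_left, zero_le, min_eq_left, List.length_nil] at h1 h2
  rw [e]
  unfold eval
  split
  · rw [if_pos ‹_›] at h2
    refine ⟨_, h1.append (h2.append ((P.run_rewind w _ []).trans
      (P.run_main w [] w rfl le_rfl []))), ?_, by simp [cfg]⟩
    simp [CounterMachine.step, cfg, prog, Transducer.readInput_end]
  · rw [if_neg ‹_›] at h2
    obtain ⟨p, d, hd, h3⟩ := h2
    refine ⟨_, h1.append (h3.append (P.run_read w (q := .bad) rfl rfl (by omega) hd)), ?_,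
      by simp [cfg]⟩
    simp [CounterMachine.step, cfg, prog]

end Machine

end ScanProgram

/-! ## Words for concepts, ontologies and instances -/

namespace ALC

variable {B : Finset BoolFun}

/-- The word for an ontology followed by an optional query. -/
def encInstance (O : Ontology B) (Q : Option (Concept B)) : List (Letter B) :=
  encOntology O ++ Q.elim [] encQuery

/-- The word for the arguments of an operator. -/
def encArgs {n : ℕ} (Cs : Fin n → Concept B) : List (Letter B) :=
  (List.ofFn fun i => encConcept (Cs i)).flatten

theorem encArgs_succ {n : ℕ} (Cs : Fin (n + 1) → Concept B) :
    encArgs Cs = encConcept (Cs 0) ++ encArgs fun i : Fin n => Cs i.succ := by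
  simp [encArgs, List.ofFn_succ]

theorem encConcept_op (f : {f : BoolFun // f ∈ B}) (Cs : Fin f.1.1 → Concept B) :
    encConcept (.op f Cs) = .op f :: encArgs Cs := rfl

theorem encArgs_getElem {n : ℕ} {Cs : List (Concept B)} (h : n ≤ Cs.length) :
    encArgs (fun i : Fin n => Cs[i.1]) = (Cs.take n).flatMap encConcept := by
  rw [encArgs, List.flatMap]
  congr 1
  apply List.ext_getElem
  · simpa using h
  · simp

/-! ### Unique readability -/

/-- The terminator makes the code prefix-free. The remainders `r`, `r'` allow such statements to be
chained along a concatenation. -/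
theorem encName_append_inj {s s' : Name} {r r' : List (Letter B)}
    (h : encName s ++ r = encName s' ++ r') : s = s' ∧ r = r' := by
  induction s generalizing s' with
  | nil => cases s' <;> simp_all [encName]
  | cons b s ih =>
    cases s' with
    | nil => simp [encName] at h
    | cons b' s' =>
      simp only [encName, List.map_cons, List.cons_append, List.cons.injEq,
        Letter.bit.injEq] at h
      obtain ⟨rfl, rfl⟩ := ih h.2
      exact ⟨by rw [h.1], rfl⟩

theorem encConcept_append_inj {C C' : Concept B} {r r' : List (Letter B)}
    (h : encConcept C ++ r = encConcept C' ++ r') : C = C' ∧ r = r' := by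
  induction C generalizing C' r r' with
  | atom A =>
    cases C' <;> simp only [encConcept, List.cons_append, List.cons.injEq, reduceCtorEq, false_and,
      true_and] at h
    obtain ⟨rfl, rfl⟩ := encName_append_inj h
    exact ⟨rfl, rfl⟩
  | op f Cs ih =>
    cases C' with
    | op f' Cs' =>
      simp only [encConcept_op, List.cons_append, List.cons.injEq, Letter.op.injEq] at h
      obtain ⟨rfl, h⟩ := h
      -- The number of arguments is detached from the arity of `f` to permit an induction on it; the
      -- induction hypotheses for the arguments become an assumption.
      have key : ∀ (n : ℕ) (F G : Fin n → Concept B), (∀ i {C' : Concept B} {r r'},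
          encConcept (F i) ++ r = encConcept C' ++ r' → F i = C' ∧ r = r') →
          encArgs F ++ r = encArgs G ++ r' → F = G ∧ r = r' := by
        intro n
        induction n with
        | zero => intro F G _ h; exact ⟨Subsingleton.elim _ _, by simpa [encArgs] using h⟩
        | succ n ihn =>
          intro F G hF h
          rw [encArgs_succ, encArgs_succ, List.append_assoc, List.append_assoc] at h
          obtain ⟨h0, h⟩ := hF 0 h
          obtain ⟨hs, h⟩ := ihn _ _ (fun i => hF i.succ) h
          refine ⟨funext fun i => ?_, h⟩
          refine Fin.cases h0 (fun i => congrFun hs i) i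
      obtain ⟨rfl, rfl⟩ := key _ Cs Cs' (fun i => ih i) h
      exact ⟨rfl, rfl⟩
    | _ => simp [encConcept] at h
  | ex R C ih =>
    cases C' <;> simp only [encConcept, List.cons_append, List.cons.injEq, reduceCtorEq, false_and,
      true_and, List.append_assoc] at h
    obtain ⟨rfl, h1⟩ := encName_append_inj h
    obtain ⟨rfl, rfl⟩ := ih h1
    exact ⟨rfl, rfl⟩
  | all R C ih =>
    cases C' <;> simp only [encConcept, List.cons_append, List.cons.injEq, reduceCtorEq, false_and,
      true_and, List.append_assoc] at h
    obtain ⟨rfl, h1⟩ := encName_append_inj h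
    obtain ⟨rfl, rfl⟩ := ih h1
    exact ⟨rfl, rfl⟩

theorem encAxiom_append_inj {a a' : OntAxiom B} {r r' : List (Letter B)}
    (h : encAxiom a ++ r = encAxiom a' ++ r') : a = a' ∧ r = r' := by
  rcases a with ⟨C, D⟩ | ⟨C, x⟩ | ⟨R, x, y⟩ <;>
    rcases a' with ⟨C', D'⟩ | ⟨C', x'⟩ | ⟨R', x', y'⟩ <;>
    simp only [encAxiom, encGCI, List.cons_append, List.cons.injEq, reduceCtorEq, false_and,
      true_and, List.append_assoc] at h
  · obtain ⟨rfl, h1⟩ := encConcept_append_inj h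
    obtain ⟨rfl, rfl⟩ := encConcept_append_inj h1
    exact ⟨rfl, rfl⟩
  · obtain ⟨rfl, h1⟩ := encConcept_append_inj h
    obtain ⟨rfl, rfl⟩ := encName_append_inj h1
    exact ⟨rfl, rfl⟩
  · obtain ⟨rfl, h1⟩ := encName_append_inj h
    obtain ⟨rfl, h2⟩ := encName_append_inj h1
    obtain ⟨rfl, rfl⟩ := encName_append_inj h2
    exact ⟨rfl, rfl⟩

theorem encInstance_cons (a : OntAxiom B) (O : Ontology B) (Q : Option (Concept B)) :
    encInstance (a :: O) Q = encAxiom a ++ encInstance O Q := by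
  simp [encInstance, encOntology]

/-- No axiom begins with `query`, so the end of the ontology is visible in the word. This identifies
any target instance that the output encodes with the translated instance. -/
theorem encInstance_inj {O O' : Ontology B} {Q Q' : Option (Concept B)}
    (h : encInstance O Q = encInstance O' Q') : O = O' ∧ Q = Q' := by
  induction O generalizing O' with
  | nil =>
    cases O' with
    | nil =>
      refine ⟨rfl, ?_⟩
      rcases Q with _ | C <;> rcases Q' with _ | C' <;>
        simp only [encInstance, encOntology, List.flatMap_nil, List.nil_append, Option.elim_some,
          Option.elim_none, encQuery, reduceCtorEq, List.cons.injEq, true_and] at h ⊢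
      exact congrArg some (encConcept_append_inj (congrArg (· ++ []) h)).1
    | cons a O' =>
      rw [encInstance_cons] at h
      rcases Q with _ | C <;> rcases a with a | ⟨C, x⟩ | ⟨R, x, y⟩ <;>
        simp [encInstance, encOntology, encAxiom, encGCI, encQuery] at h
  | cons a O ih =>
    cases O' with
    | nil =>
      rw [encInstance_cons] at h
      rcases Q' with _ | C <;> rcases a with a | ⟨C, x⟩ | ⟨R, x, y⟩ <;>
        simp [encInstance, encOntology, encAxiom, encGCI, encQuery] at h
    | cons a' O' =>
      rw [encInstance_cons, encInstance_cons] at h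
      obtain ⟨rfl, h1⟩ := encAxiom_append_inj h
      obtain ⟨rfl, rfl⟩ := ih h1
      exact ⟨rfl, rfl⟩

/-- Makes `[.endName]` a safe output for malformed input. -/
theorem encInstance_ne_endName (O : Ontology B) (Q : Option (Concept B)) :
    encInstance O Q ≠ [.endName] := by
  rcases O with _ | ⟨a, O⟩
  · rcases Q with _ | C <;> simp [encInstance, encOntology, encQuery]
  · rw [encInstance_cons]
    rcases a with a | ⟨C, x⟩ | ⟨R, x, y⟩ <;> simp [encAxiom, encGCI]

/-! ### Skipping names and concepts -/

/-- The number of items (names or concepts) by which a letter replaces one pending item. -/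
def Letter.arity : Letter B → ℕ
  | .bit _ => 1
  | .op f => f.1.1
  | .atom => 1
  | .ex => 2
  | .all => 2
  | _ => 0

open ScanProgram

theorem skip_encName (d : ℕ) (s : Name) (r : List (Letter B)) :
    skip Letter.arity (d + 1) (encName s ++ r) = skip Letter.arity d r := by
  induction s with
  | nil => simp [encName, skip, Letter.arity]
  | cons b s ih => simpa [encName, skip, Letter.arity] using ih

theorem skip_encArgs_of {n : ℕ} (Cs : Fin n → Concept B)
    (h : ∀ i d r, skip Letter.arity (d + 1) (encConcept (Cs i) ++ r) = skip Letter.arity d r)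
    (d : ℕ) (r : List (Letter B)) :
    skip Letter.arity (d + n) (encArgs Cs ++ r) = skip Letter.arity d r := by
  induction n with
  | zero => simp [encArgs]
  | succ n ih =>
    rw [encArgs_succ, ← add_assoc, List.append_assoc, h, ih _ fun i => h i.succ]

/-- In prefix notation each letter opens as many items as it has names and concepts to follow, so a
complete concept closes exactly one item. -/
theorem skip_encConcept (d : ℕ) (C : Concept B) (r : List (Letter B)) :
    skip Letter.arity (d + 1) (encConcept C ++ r) = skip Letter.arity d r := by
  induction C generalizing d r with
  | atom A => simpa [encConcept, skip, Letter.arity] using skip_encName d A r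
  | op f Cs ih =>
    simpa [encConcept_op, skip, Letter.arity] using skip_encArgs_of Cs (fun i d r => ih i d r) d r
  | ex R C ih => simp [encConcept, skip, Letter.arity, skip_encName, ih]
  | all R C ih => simp [encConcept, skip, Letter.arity, skip_encName, ih]

/-- Exhibits the suffix at an argument as that argument followed by a remainder, the form in which
suffixes enter `definitions`. -/
theorem skip_encArgs {n : ℕ} (Cs : Fin n → Concept B) (i : Fin n) (r : List (Letter B)) :
    skip Letter.arity i (encArgs Cs ++ r) =
      encConcept (Cs i) ++ skip Letter.arity (i + 1) (encArgs Cs ++ r) := by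
  induction n with
  | zero => exact i.elim0
  | succ n ih =>
    rw [encArgs_succ, List.append_assoc]
    refine Fin.cases ?_ (fun i => ?_) i
    · simp [skip_encConcept 0, skip]
    · rw [Fin.val_succ, skip_encConcept, skip_encConcept]
      exact ih (fun i => Cs i.succ) i

/-! ### Recognizing well-formed words -/

/-- The number of names that have to follow the pending concepts. -/
inductive Trailing : Type
  | zero : Trailing
  | one : Trailing
  | two : Trailing

instance : Finite Trailing :=
  Finite.of_injective
    (fun t : Trailing => (match t with | .zero => 0 | .one => 1 | .two => 2 : Fin 3))
    (by intro a b h; cases a <;> cases b <;> simp_all)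

/-- The predecessor. -/
def Trailing.pred : Trailing → Trailing
  | .zero => .zero
  | .one => .zero
  | .two => .one

/-- The number. -/
def Trailing.val : Trailing → ℕ
  | .zero => 0
  | .one => 1
  | .two => 2

/-- The mode of the recognizer: whether it is reading a name, how many names follow the pending
concepts, and whether the query has begun. -/
abbrev Mode : Type := Bool × Trailing × Bool

/-- One step of the recognizer. `ab` tells whether assertions are allowed, `q` whether a query is
required; the Boolean argument tells whether concepts are pending, and the number in the result is
the number of concepts that replace a pending one. -/
def recognize (ab q : Bool) : Mode → Bool → Letter B → Option (Mode × ℕ)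
  | (true, t, s), nz, .bit _ => some ((true, t, s), nz.toNat)
  | (true, t, s), nz, .endName => some ((false, t, s), nz.toNat)
  | (false, t, s), true, .atom => some ((true, t, s), 0)
  | (false, t, s), true, .op f => some ((false, t, s), f.1.1)
  | (false, t, s), true, .ex => some ((true, t, s), 1)
  | (false, t, s), true, .all => some ((true, t, s), 1)
  | (false, .zero, false), false, .gci => some ((false, .zero, false), 2)
  | (false, .zero, false), false, .conceptAssertion =>
    if ab then some ((false, .one, false), 1) else none
  | (false, .zero, false), false, .roleAssertion =>
    if ab then some ((true, .two, false), 0) else none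
  | (false, .zero, false), false, .query => if q then some ((false, .zero, true), 1) else none
  | (false, .zero, _), false, _ => none
  | (false, t, s), false, .bit _ => some ((true, t.pred, s), 0)
  | (false, t, s), false, .endName => some ((false, t.pred, s), 0)
  | _, _, _ => none

/-- The accepting modes. -/
def acceptMode (q : Bool) : Mode → Bool
  | (false, .zero, s) => s == q
  | _ => false

/-- The words accepted from mode `s` with `d` pending concepts. -/
def recognizes (ab q : Bool) : Mode → ℕ → List (Letter B) → Bool
  | s, d, [] => acceptMode q s && d == 0
  | s, d, a :: u =>
    match recognize ab q s (d != 0) a with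
    | none => false
    | some (s', m) => recognizes ab q s' (d - 1 + m) u

/-- An axiom that is an inclusion. -/
def OntAxiom.IsInclusion : OntAxiom B → Prop
  | .inclusion _ => True
  | _ => False

/-! ### Correctness of the recognizer of well-formed words. -/

section Recognizer

variable (ab q : Bool)

theorem recognizes_encName (t : Trailing) (s : Bool) (d : ℕ) (x : Name) (r : List (Letter B)) :
    recognizes ab q (true, t, s) d (encName x ++ r) = recognizes ab q (false, t, s) d r := by
  -- Each step removes a pending concept if there is one; inside a name the recognizer puts it back.
  have hd : d - 1 + (d != 0).toNat = d := by rcases d with _ | d <;> simp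
  induction x with
  | nil => simp [encName, recognizes, recognize, hd]
  | cons b x ih => simpa [encName, recognizes, recognize, hd] using ih

/-- A trailing name has no opening letter: its own first letter, possibly the terminator, lowers the
count. -/
theorem recognizes_trailing (t : Trailing) (ht : t ≠ .zero) (s : Bool) (x : Name)
    (r : List (Letter B)) :
    recognizes ab q (false, t, s) 0 (encName x ++ r) = recognizes ab q (false, t.pred, s) 0 r := by
  rcases x with _ | ⟨b, x⟩
  · cases t <;> simp_all [encName, recognizes, recognize]
  · rw [← recognizes_encName ab q t.pred s 0 x]
    cases t <;> simp_all [encName, recognizes, recognize]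

theorem recognizes_encConcept (t : Trailing) (s : Bool) (d : ℕ) (C : Concept B)
    (r : List (Letter B)) :
    recognizes ab q (false, t, s) (d + 1) (encConcept C ++ r) =
      recognizes ab q (false, t, s) d r := by
  induction C generalizing d r with
  | atom A =>
    rw [← recognizes_encName ab q t s d A r]
    simp [encConcept, recognizes, recognize]
  | op f Cs ih =>
    have key : ∀ (n : ℕ) (F : Fin n → Concept B), (∀ i (d : ℕ) (r : List (Letter B)),
        recognizes ab q (false, t, s) (d + 1) (encConcept (F i) ++ r) =
          recognizes ab q (false, t, s) d r) →
        recognizes ab q (false, t, s) (d + n) (encArgs F ++ r) =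
          recognizes ab q (false, t, s) d r := by
      intro n
      induction n with
      | zero => simp [encArgs]
      | succ n ihn =>
        intro F hF
        rw [encArgs_succ, ← add_assoc, List.append_assoc, hF, ihn _ fun i => hF i.succ]
    rw [← key _ Cs fun i d r => ih i d r]
    simp [encConcept_op, recognizes, recognize]
  | ex R C ih =>
    rw [← ih d r, ← recognizes_encName ab q t s (d + 1) R (encConcept C ++ r)]
    simp [encConcept, recognizes, recognize]
  | all R C ih =>
    rw [← ih d r, ← recognizes_encName ab q t s (d + 1) R (encConcept C ++ r)]
    simp [encConcept, recognizes, recognize]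

theorem recognizes_encAxiom (a : OntAxiom B) (ha : ab = false → a.IsInclusion)
    (r : List (Letter B)) :
    recognizes ab q (false, .zero, false) 0 (encAxiom a ++ r) =
      recognizes ab q (false, .zero, false) 0 r := by
  rcases a with ⟨C, D⟩ | ⟨C, x⟩ | ⟨R, x, y⟩
  · rw [← recognizes_encConcept ab q .zero false 0 D r,
      ← recognizes_encConcept ab q .zero false 1 C]
    simp [encAxiom, encGCI, recognizes, recognize]
  · have hab : ab = true := by by_contra h; exact ha (by simpa using h)
    have h1 := recognizes_trailing ab q .one (by simp) false x r
    rw [← recognizes_encConcept ab q .one false 0 C] at h1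
    rw [show Trailing.one.pred = .zero from rfl] at h1
    rw [← h1]
    simp [encAxiom, recognizes, recognize, hab]
  · have hab : ab = true := by by_contra h; exact ha (by simpa using h)
    have h1 := recognizes_trailing ab q .one (by simp) false y r
    have h2 := recognizes_trailing ab q .two (by simp) false x (encName y ++ r)
    rw [show Trailing.one.pred = .zero from rfl] at h1
    rw [show Trailing.two.pred = .one from rfl, h1, ← recognizes_encName ab q _ _ _ R] at h2
    rw [← h2]
    simp [encAxiom, recognizes, recognize, hab]

theorem recognizes_encInstance (O : Ontology B) (Q : Option (Concept B))
    (hO : ab = false → ∀ a ∈ O, a.IsInclusion) (hQ : Q.isSome = q) :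
    recognizes ab q (false, .zero, false) 0 (encInstance O Q) = true := by
  induction O with
  | nil =>
    subst hQ
    rcases Q with _ | C
    · simp [encInstance, encOntology, recognizes, acceptMode]
    · have h := recognizes_encConcept ab true .zero true 0 C []
      rw [show recognizes ab true (false, Trailing.zero, true) 0 ([] : List (Letter B)) = true by
        simp [recognizes, acceptMode], List.append_nil] at h
      rw [← h]
      simp [encInstance, encOntology, encQuery, recognizes, recognize]
  | cons a O ih =>
    rw [encInstance_cons, recognizes_encAxiom ab q a fun h => hO h a (by simp)]
    exact ih fun h b hb => hO h b (by simp [hb])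

/-- The words to be accepted from a mode with `d` pending concepts. -/
def Parses : Mode → ℕ → List (Letter B) → Prop
  | (n, t, s), d, w =>
    ∃ (x : Name) (Cs : List (Concept B)) (xs : List Name) (O : Ontology B)
      (Q : Option (Concept B)),
      w = (if n then encName x else []) ++ (Cs.flatMap encConcept ++ (xs.flatMap encName ++
        encInstance O Q)) ∧ Cs.length = d ∧ xs.length = t.val ∧
      (ab = false → ∀ a ∈ O, a.IsInclusion) ∧
      if s then O = [] ∧ Q = none else Q.isSome = q

/-- The word is read backwards: each letter, put in front of a parse of the rest, absorbs the items
that it had announced into one name, concept, axiom or query. -/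
theorem parses_of_recognizes (m : Mode) (d : ℕ) (w : List (Letter B))
    (h : recognizes ab q m d w = true) : Parses ab q m d w := by
  induction w generalizing m d with
  | nil =>
    obtain ⟨n, t, s⟩ := m
    simp only [recognizes, Bool.and_eq_true, beq_iff_eq] at h
    obtain ⟨h, rfl⟩ := h
    cases n <;> cases t <;> simp only [acceptMode, beq_iff_eq, Bool.false_eq_true] at h
    subst h
    refine ⟨[], [], [], [], none, by simp [encInstance, encOntology], rfl, rfl, by simp, ?_⟩
    cases s <;> simp
  | cons a u ih =>
    obtain ⟨n, t, s⟩ := m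
    simp only [recognizes] at h
    split at h
    · cases h
    rename_i m' k hr
    obtain ⟨n', t', s'⟩ := m'
    obtain ⟨x, Cs, xs, O, Q, hu, hC, hx, hO, hQ⟩ := ih _ _ h
    clear ih h
    subst hu
    cases n
    · rcases d with _ | d
      · cases t
        · cases s <;> cases a <;> simp only [recognize, bne_self_eq_false, reduceCtorEq,
            Option.some.injEq, Prod.mk.injEq, Option.ite_none_right_eq_some] at hr
          · obtain ⟨⟨rfl, rfl, rfl⟩, rfl⟩ := hr
            obtain ⟨C, D, rfl⟩ := List.length_eq_two.1 hC
            obtain rfl := List.eq_nil_of_length_eq_zero hx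
            refine ⟨[], [], [], .inclusion ⟨C, D⟩ :: O, Q, ?_, rfl, rfl, ?_, hQ⟩
            · simp [encInstance_cons, encAxiom, encGCI]
            · intro h a ha
              rcases List.mem_cons.1 ha with rfl | ha
              · trivial
              · exact hO h a ha
          · obtain ⟨rfl, ⟨rfl, rfl, rfl⟩, rfl⟩ := hr
            obtain ⟨C, rfl⟩ := List.length_eq_one_iff.1 hC
            obtain ⟨y, rfl⟩ := List.length_eq_one_iff.1 hx
            refine ⟨[], [], [], .conceptAssertion C y :: O, Q, ?_, rfl, rfl, by simp, hQ⟩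
            simp [encInstance_cons, encAxiom]
          · obtain ⟨rfl, ⟨rfl, rfl, rfl⟩, rfl⟩ := hr
            obtain rfl := List.eq_nil_of_length_eq_zero hC
            obtain ⟨y, z, rfl⟩ := List.length_eq_two.1 hx
            refine ⟨[], [], [], .roleAssertion x y z :: O, Q, ?_, rfl, rfl, by simp, hQ⟩
            simp [encInstance_cons, encAxiom]
          · obtain ⟨rfl, ⟨rfl, rfl, rfl⟩, rfl⟩ := hr
            obtain ⟨C, rfl⟩ := List.length_eq_one_iff.1 hC
            obtain rfl := List.eq_nil_of_length_eq_zero hx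
            -- After `query` the parse of the rest contains neither axioms nor a second query.
            obtain ⟨rfl, rfl⟩ := hQ
            refine ⟨[], [], [], [], some C, ?_, rfl, rfl, by simp, by simp⟩
            simp [encInstance, encOntology, encQuery]
        all_goals
          cases a <;> simp only [recognize, bne_self_eq_false, reduceCtorEq,
            Option.some.injEq, Prod.mk.injEq, Trailing.pred] at hr
          all_goals
            obtain ⟨⟨rfl, rfl, rfl⟩, rfl⟩ := hr
            obtain rfl := List.eq_nil_of_length_eq_zero hC
          · rename_i b
            refine ⟨[], [], (b :: x) :: xs, O, Q, by simp [encName], rfl, ?_, hO, hQ⟩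
            simpa [Trailing.val] using hx
          · refine ⟨[], [], [] :: xs, O, Q, by simp [encName], rfl, ?_, hO, hQ⟩
            simpa [Trailing.val] using hx
      · have hd : (d + 1 != 0) = true := by simp
        rw [hd] at hr
        cases a <;> simp only [recognize, reduceCtorEq, Option.some.injEq, Prod.mk.injEq] at hr
        all_goals
          obtain ⟨⟨rfl, rfl, rfl⟩, rfl⟩ := hr
        · refine ⟨[], .atom x :: Cs, xs, O, Q, by simp [encConcept], by simpa using hC, hx, hO, hQ⟩
        · rename_i f
          have hl : f.1.1 ≤ Cs.length := by omega
          -- The operator takes the first `f.1.1` parsed concepts as arguments; the others remain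
          -- pending.
          refine ⟨[], .op f (fun i => Cs[i.1]) :: Cs.drop f.1.1, xs, O, Q, ?_, ?_, hx, hO, hQ⟩
          · simp only [Bool.false_eq_true, if_false, List.nil_append, List.flatMap_cons,
              encConcept_op, encArgs_getElem hl, List.cons_append]
            rw [← List.append_assoc (List.flatMap _ _), ← List.flatMap_append,
              List.take_append_drop, List.append_assoc]
          · simp; omega
        · obtain ⟨C, Cs, rfl⟩ := List.exists_cons_of_length_eq_add_one (n := d) hC
          refine ⟨[], .ex x C :: Cs, xs, O, Q, by simp [encConcept], ?_, hx, hO, hQ⟩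
          simpa using hC
        · obtain ⟨C, Cs, rfl⟩ := List.exists_cons_of_length_eq_add_one (n := d) hC
          refine ⟨[], .all x C :: Cs, xs, O, Q, by simp [encConcept], ?_, hx, hO, hQ⟩
          simpa using hC
    · have hd : d - 1 + (d != 0).toNat = d := by rcases d with _ | d <;> simp
      cases a <;> simp only [recognize, reduceCtorEq, Option.some.injEq, Prod.mk.injEq] at hr
      all_goals
        obtain ⟨⟨rfl, rfl, rfl⟩, rfl⟩ := hr
        rw [hd] at hC
      · rename_i b
        exact ⟨b :: x, Cs, xs, O, Q, by simp [encName], hC, hx, hO, hQ⟩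
      · exact ⟨[], Cs, xs, O, Q, by simp [encName], hC, hx, hO, hQ⟩

theorem exists_encInstance_of_recognizes {w : List (Letter B)}
    (h : recognizes ab q (false, .zero, false) 0 w = true) :
    ∃ (O : Ontology B) (Q : Option (Concept B)), w = encInstance O Q ∧
      (ab = false → ∀ a ∈ O, a.IsInclusion) ∧ Q.isSome = q := by
  obtain ⟨x, Cs, xs, O, Q, hu, hC, hx, hO, hQ⟩ := parses_of_recognizes ab q _ _ _ h
  obtain rfl := List.eq_nil_of_length_eq_zero hC
  obtain rfl := List.eq_nil_of_length_eq_zero hx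
  exact ⟨O, Q, by simpa using hu, hO, hQ⟩

end Recognizer

end ALC

/-! ## Terms over a set of Boolean functions -/

/-- Terms over `B` with variables in `V`. -/
inductive BoolTerm (B : Finset BoolFun) (V : Type) : Type
  | var : V → BoolTerm B V
  | app : (f : {f : BoolFun // f ∈ B}) → (Fin f.1.1 → BoolTerm B V) → BoolTerm B V

namespace BoolTerm

variable {B : Finset BoolFun} {V W : Type}

/-- The value of a term. -/
def eval (v : V → Bool) : BoolTerm B V → Bool
  | .var x => v x
  | .app f ts => f.1.2 fun i => (ts i).eval v

/-- Substitution. -/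
def subst (σ : V → BoolTerm B W) : BoolTerm B V → BoolTerm B W
  | .var x => σ x
  | .app f ts => .app f fun i => (ts i).subst σ

theorem eval_subst (σ : V → BoolTerm B W) (v : W → Bool) (t : BoolTerm B V) :
    (t.subst σ).eval v = t.eval fun x => (σ x).eval v := by
  induction t with
  | var x => rfl
  | app f ts ih => simp [subst, eval, ih]

/-- Every function in the clone of `B` is represented by a term over `B`, which may contain a
dummy variable `none`. -/
theorem exists_of_mem_cloneOf {f : BoolFun} (hf : f ∈ cloneOf (B : Set BoolFun)) :
    ∃ t : BoolTerm B (Option (Fin f.1)), ∀ v : Option (Fin f.1) → Bool,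
      t.eval v = f.2 fun i => v (some i) := by
  -- The functions represented by such terms form a clone containing `B`, hence one of the sets
  -- whose intersection is `cloneOf B`.
  refine hf {f | ∃ t : BoolTerm B (Option (Fin f.1)), ∀ v : Option (Fin f.1) → Bool,
      t.eval v = f.2 fun i => v (some i)} ⟨⟨?_, ?_, ?_⟩, ?_⟩
  · intro n i
    exact ⟨.var (some i), fun v => rfl⟩
  · rintro n m f g ⟨t, ht⟩ hg
    choose u hu using hg
    refine ⟨t.subst fun x => x.elim (.var none) u, fun v => ?_⟩
    rw [eval_subst, ht]
    simp [hu]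
  · rintro b ⟨t, ht⟩
    -- Here the dummy is indispensable: passing from a unary to a nullary constant removes the
    -- variable that the term may contain.
    refine ⟨t.subst fun _ => .var none, fun v => ?_⟩
    rw [eval_subst]
    exact ht fun _ => v none
  · intro f hf
    exact ⟨.app ⟨f, hf⟩ fun i => .var (some i), fun v => rfl⟩

end BoolTerm

/-! ## The translation of instances -/

namespace ALC

variable {B B' : Finset BoolFun}

/-- The concept obtained by substituting concepts for the variables of a term. -/
def _root_.BoolTerm.toConcept {V : Type} (σ : V → Concept B) : BoolTerm B V → Concept B
  | .var x => σ x
  | .app f ts => .op f fun i => (ts i).toConcept σ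

open Classical in
theorem Interp.mem_ext_toConcept (I : Interp) {V : Type} (σ : V → Concept B) (t : BoolTerm B V)
    (x : I.Dom) :
    x ∈ I.ext (t.toConcept σ) ↔ t.eval (fun v => decide (x ∈ I.ext (σ v))) = true := by
  induction t with
  | var v => simp [BoolTerm.toConcept, BoolTerm.eval]
  | app f ts ih =>
    have : ∀ i, decide (x ∈ I.ext ((ts i).toConcept σ)) =
        (ts i).eval fun v => decide (x ∈ I.ext (σ v)) := fun i => by
      rw [Bool.eq_iff_iff, decide_eq_true_iff, ih]
    simp [BoolTerm.toConcept, BoolTerm.eval, Interp.ext, this]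

/-- The name `1ᵏ`, which stands for the concept that begins `k` letters before the end of the
instance; the empty name stands for the query. -/
def numeral (k : ℕ) : Concept B' := .atom (List.replicate k true)

/-- A choice of terms over `B'`, possibly with a dummy variable, for the operators in `B`. -/
abbrev TermChoice (B B' : Finset BoolFun) : Type :=
  (f : {f : BoolFun // f ∈ B}) → BoolTerm B' (Option (Fin f.1.1))

/-- The two inclusions between a pair of concepts. -/
def equivalence (C D : Concept B') : TBox B' := [⟨C, D⟩, ⟨D, C⟩]

open ScanProgram (skip)

/-- The names of the arguments of an operator, where `u` is the word that begins with them. -/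
def argNames {n : ℕ} (u : List (Letter B)) : Option (Fin n) → Concept B'
  -- Any concept would do, since the terms chosen do not depend on their dummy variable.
  | none => numeral 0
  | some i => numeral (skip Letter.arity i u).length

/-- The inclusions that define the names of the subconcepts of a concept followed by `r`. -/
def definitions (T : TermChoice B B') : Concept B → List (Letter B) → TBox B'
  | .atom A, r => equivalence (numeral (encConcept (.atom A) ++ r).length) (.atom (false :: A))
  | .op f Cs, r =>
    equivalence (numeral (encConcept (.op f Cs) ++ r).length)
      ((T f).toConcept (argNames (encArgs Cs ++ r))) ++
    (List.ofFn fun i => definitions T (Cs i) (skip Letter.arity (i + 1) (encArgs Cs ++ r))).flatten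
  | .ex R C, r =>
    equivalence (numeral (encConcept (.ex R C) ++ r).length)
      (.ex R (numeral (encConcept C ++ r).length)) ++ definitions T C r
  | .all R C, r =>
    equivalence (numeral (encConcept (.all R C) ++ r).length)
      (.all R (numeral (encConcept C ++ r).length)) ++ definitions T C r

/-- The translation of an axiom followed by `r`. -/
def translateAxiom (T : TermChoice B B') : OntAxiom B → List (Letter B) → Ontology B'
  | .inclusion ⟨C, D⟩, r =>
    .inclusion ⟨numeral (encConcept C ++ (encConcept D ++ r)).length,
      numeral (encConcept D ++ r).length⟩ ::
      (definitions T C (encConcept D ++ r) ++ definitions T D r).map .inclusion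
  | .conceptAssertion C x, r =>
    .conceptAssertion (numeral (encConcept C ++ (encName x ++ r)).length) x ::
      (definitions T C (encName x ++ r)).map .inclusion
  | .roleAssertion R x y, _ => [.roleAssertion R x y]

/-- The inclusions for the query. -/
def translateQuery (T : TermChoice B B') (C : Concept B) : TBox B' :=
  ⟨numeral 0, numeral (encConcept C).length⟩ :: definitions T C []

/-- The translation of an ontology with an optional query. -/
def translateOntology (T : TermChoice B B') : Ontology B → Option (Concept B) → Ontology B'
  | [], Q => (Q.elim [] (translateQuery T)).map .inclusion
  | a :: O, Q => translateAxiom T a (encInstance O Q) ++ translateOntology T O Q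

/-! ### Equisatisfiability -/

/-- An interpretation satisfies an ontology and makes the optional query nonempty. -/
def Interp.Satisfies (I : Interp) (O : Ontology B) (Q : Option (Concept B)) : Prop :=
  I.ModelsOntology O ∧ ∀ C ∈ Q, (I.ext C).Nonempty

theorem Interp.models_equivalence {I : Interp} {C D : Concept B'} :
    I.ModelsTBox (equivalence C D) ↔ I.ext C = I.ext D := by
  simp [ModelsTBox, equivalence, SatGCI, Set.Subset.antisymm_iff]

theorem Interp.modelsTBox_append {I : Interp} {S T : TBox B} :
    I.ModelsTBox (S ++ T) ↔ I.ModelsTBox S ∧ I.ModelsTBox T := List.forall_mem_append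

theorem Interp.modelsOntology_append {I : Interp} {S T : Ontology B} :
    I.ModelsOntology (S ++ T) ↔ I.ModelsOntology S ∧ I.ModelsOntology T := List.forall_mem_append

theorem Interp.modelsOntology_cons {I : Interp} {a : OntAxiom B} {O : Ontology B} :
    I.ModelsOntology (a :: O) ↔ I.SatAxiom a ∧ I.ModelsOntology O := List.forall_mem_cons

theorem Interp.modelsOntology_map {I : Interp} {T : TBox B} :
    I.ModelsOntology (T.map .inclusion) ↔ I.ModelsTBox T := List.forall_mem_map

theorem Interp.modelsTBox_flatten_ofFn {I : Interp} {n : ℕ} {T : Fin n → TBox B} :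
    I.ModelsTBox (List.ofFn T).flatten ↔ ∀ i, I.ModelsTBox (T i) := by
  simp only [ModelsTBox, List.mem_flatten, List.mem_ofFn]
  constructor
  · intro h i a ha
    exact h a ⟨_, ⟨i, rfl⟩, ha⟩
  · rintro h a ⟨_, ⟨i, rfl⟩, ha⟩
    exact h i a ha

/-! ### Models of an instance versus models of its translation. -/

section Semantics

variable {T : TermChoice B B'}

open Classical in
theorem Interp.ext_toConcept_argNames (hT : ∀ f v, (T f).eval v = f.1.2 fun i => v (some i))
    (J : Interp) (f : {f : BoolFun // f ∈ B}) (u : List (Letter B)) (X : Fin f.1.1 → Set J.Dom)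
    (h : ∀ i : Fin f.1.1, J.ext (B := B') (numeral (skip Letter.arity i u).length) = X i) :
    J.ext ((T f).toConcept (argNames u)) = {x | f.1.2 (fun i => decide (x ∈ X i)) = true} := by
  ext x
  rw [mem_ext_toConcept, hT]
  simp only [argNames, h]
  rfl

/-- The interpretation of the original names in a model of the translation. -/
def Interp.pullback (J : Interp) : Interp where
  Dom := J.Dom
  nonemptyDom := J.nonemptyDom
  conc A := J.conc (false :: A)
  role := J.role
  ind := J.ind

/-- By induction on `C`, the defining equivalences force each name to denote its concept. The
remainder `r` varies, because each argument is followed by a different suffix. -/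
theorem Interp.ext_pullback (hT : ∀ f v, (T f).eval v = f.1.2 fun i => v (some i)) (J : Interp)
    (C : Concept B) (r : List (Letter B)) (h : J.ModelsTBox (definitions T C r)) :
    J.pullback.ext C = J.ext (B := B') (numeral (encConcept C ++ r).length) := by
  induction C generalizing r with
  | atom A =>
    rw [definitions, models_equivalence] at h
    rw [h]; rfl
  | op f Cs ih =>
    rw [definitions, modelsTBox_append, models_equivalence, modelsTBox_flatten_ofFn] at h
    rw [h.1, ext_toConcept_argNames hT J f _ (fun i => J.pullback.ext (Cs i)) fun i => by
      rw [skip_encArgs]; exact (ih i _ (h.2 i)).symm]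
    rfl
  | ex R C ih =>
    rw [definitions, modelsTBox_append, models_equivalence] at h
    rw [h.1, Interp.ext, Interp.ext, ih r h.2]; rfl
  | all R C ih =>
    rw [definitions, modelsTBox_append, models_equivalence] at h
    rw [h.1, Interp.ext, Interp.ext, ih r h.2]; rfl

/-- The interpretation of the new names in a model of the instance `w`, where `X` is the extension
of the query. -/
def Interp.pushforward (I : Interp) (B : Finset BoolFun) (w : List (Letter B)) (X : Set I.Dom) :
    Interp where
  Dom := I.Dom
  nonemptyDom := I.nonemptyDom
  conc
    | [] => X
    | false :: A => I.conc A
    | true :: s => {x | ∃ (C : Concept B) (r : List (Letter B)), encConcept C ++ r <:+ w ∧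
        (encConcept C ++ r).length = s.length + 1 ∧ x ∈ I.ext C}
  role := I.role
  ind := I.ind

theorem encConcept_ne_nil (C : Concept B) : encConcept C ≠ [] := by
  cases C <;> simp [encConcept]

/-- A name determines the length of a suffix of `w`, hence the suffix, hence by unique readability
the concept at its beginning. So the existential in `pushforward` has only one candidate. -/
theorem Interp.ext_pushforward_numeral (I : Interp) {w : List (Letter B)} (X : Set I.Dom)
    {C : Concept B} {r : List (Letter B)} (h : encConcept C ++ r <:+ w) :
    (I.pushforward B w X).ext (B := B') (numeral (encConcept C ++ r).length) = I.ext C := by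
  obtain ⟨k, hk⟩ : ∃ k, (encConcept C ++ r).length = k + 1 :=
    Nat.exists_eq_add_one.2 (by simp [List.length_pos_iff, encConcept_ne_nil])
  rw [hk, numeral, List.replicate_succ]
  ext x
  constructor
  · rintro ⟨C', r', h', hl, hx⟩
    rw [List.length_replicate, ← hk] at hl
    have e := (List.suffix_of_suffix_length_le h h' hl.ge).eq_of_length hl.symm
    rwa [(encConcept_append_inj e).1]
  · intro hx
    exact ⟨C, r, h, by simpa using hk, hx⟩

theorem skip_suffix {α : Type} (ar : α → ℕ) (d : ℕ) (u : List α) : skip ar d u <:+ u := by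
  induction u generalizing d with
  | nil => cases d <;> simp [skip]
  | cons a u ih =>
    rcases d with _ | d
    · simp [skip]
    · exact (ih _).trans (List.suffix_cons a u)

theorem Interp.pushforward_models_definitions
    (hT : ∀ f v, (T f).eval v = f.1.2 fun i => v (some i)) (I : Interp) {w : List (Letter B)}
    (X : Set I.Dom) {C : Concept B} {r : List (Letter B)} (h : encConcept C ++ r <:+ w) :
    (I.pushforward B w X).ModelsTBox (definitions T C r) := by
  induction C generalizing r with
  | atom A =>
    rw [definitions, models_equivalence, I.ext_pushforward_numeral X h]; rfl
  | op f Cs ih =>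
    have h' : encArgs Cs ++ r <:+ w := by
      rw [encConcept_op, List.cons_append] at h
      exact (List.suffix_cons _ _).trans h
    have hi : ∀ i, encConcept (Cs i) ++ skip Letter.arity (i + 1) (encArgs Cs ++ r) <:+ w := by
      intro i
      rw [← skip_encArgs]
      exact (skip_suffix ..).trans h'
    rw [definitions, modelsTBox_append, models_equivalence, modelsTBox_flatten_ofFn,
      I.ext_pushforward_numeral X h]
    refine ⟨?_, fun i => ih i (hi i)⟩
    refine (ext_toConcept_argNames hT (I.pushforward B w X) f (encArgs Cs ++ r)
      (fun i => I.ext (Cs i)) fun i => ?_).symm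
    rw [skip_encArgs]
    exact I.ext_pushforward_numeral X (hi i)
  | ex R C ih =>
    have h' : encConcept C ++ r <:+ w := by
      rw [encConcept, List.cons_append, List.append_assoc] at h
      exact (List.suffix_append _ _).trans ((List.suffix_cons _ _).trans h)
    rw [definitions, modelsTBox_append, models_equivalence, I.ext_pushforward_numeral X h]
    refine ⟨?_, ih h'⟩
    rw [Interp.ext, Interp.ext, I.ext_pushforward_numeral X h']; rfl
  | all R C ih =>
    have h' : encConcept C ++ r <:+ w := by
      rw [encConcept, List.cons_append, List.append_assoc] at h
      exact (List.suffix_append _ _).trans ((List.suffix_cons _ _).trans h)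
    rw [definitions, modelsTBox_append, models_equivalence, I.ext_pushforward_numeral X h]
    refine ⟨?_, ih h'⟩
    rw [Interp.ext, Interp.ext, I.ext_pushforward_numeral X h']; rfl

theorem Interp.pullback_satisfies (hT : ∀ f v, (T f).eval v = f.1.2 fun i => v (some i))
    (J : Interp) (O : Ontology B) (Q : Option (Concept B))
    (h : J.Satisfies (translateOntology T O Q) (Q.map fun _ => numeral 0)) :
    J.pullback.Satisfies O Q := by
  obtain ⟨h, hQ⟩ := h
  induction O with
  | nil =>
    refine ⟨by simp [ModelsOntology], ?_⟩
    rintro C hC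
    rw [Option.mem_def] at hC
    subst hC
    simp only [translateOntology, Option.elim_some, translateQuery, modelsOntology_map] at h
    obtain ⟨h1, h2⟩ := List.forall_mem_cons.1 h
    have h3 := J.ext_pullback hT C [] h2
    rw [List.append_nil] at h3
    rw [h3]
    exact (hQ (numeral 0) rfl).mono h1
  | cons a O ih =>
    rw [translateOntology, modelsOntology_append] at h
    refine ⟨?_, (ih h.2).2⟩
    rw [modelsOntology_cons]
    refine ⟨?_, (ih h.2).1⟩
    replace h := h.1
    rcases a with ⟨C, D⟩ | ⟨C, x⟩ | ⟨R, x, y⟩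
    · rw [translateAxiom, modelsOntology_cons, modelsOntology_map, modelsTBox_append] at h
      obtain ⟨h1, h2, h3⟩ := h
      simp only [SatAxiom, SatGCI] at h1 ⊢
      rwa [J.ext_pullback hT C _ h2, J.ext_pullback hT D _ h3]
    · rw [translateAxiom, modelsOntology_cons, modelsOntology_map] at h
      obtain ⟨h1, h2⟩ := h
      simp only [SatAxiom] at h1 ⊢
      rwa [J.ext_pullback hT C _ h2]
    · rw [translateAxiom, modelsOntology_cons] at h
      exact h.1

/-- The word `w` stays fixed while the ontology shrinks along its suffixes, since the names are
interpreted with respect to the whole instance. -/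
theorem Interp.pushforward_models (hT : ∀ f v, (T f).eval v = f.1.2 fun i => v (some i))
    (I : Interp) {w : List (Letter B)} (X : Set I.Dom) (O : Ontology B) (Q : Option (Concept B))
    (hX : ∀ C ∈ Q, X ⊆ I.ext C) (h : I.ModelsOntology O) (hw : encInstance O Q <:+ w) :
    (I.pushforward B w X).ModelsOntology (translateOntology T O Q) := by
  induction O with
  | nil =>
    rcases Q with _ | C
    · simp [translateOntology, ModelsOntology]
    · have hC : encConcept C ++ [] <:+ w := by
        rw [List.append_nil]
        exact (List.suffix_cons _ _).trans hw
      have e := I.ext_pushforward_numeral (B' := B') X hC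
      rw [List.append_nil] at e
      rw [translateOntology, modelsOntology_map]
      refine List.forall_mem_cons.2 ⟨?_, I.pushforward_models_definitions hT X hC⟩
      rw [SatGCI, e]
      exact hX C rfl
  | cons a O ih =>
    rw [modelsOntology_cons] at h
    rw [encInstance_cons] at hw
    rw [translateOntology, modelsOntology_append]
    refine ⟨?_, ih h.2 ((List.suffix_append _ _).trans hw)⟩
    replace h := h.1
    rcases a with ⟨C, D⟩ | ⟨C, x⟩ | ⟨R, x, y⟩
    · rw [encAxiom, encGCI, List.cons_append, List.append_assoc] at hw
      have hC := (List.suffix_cons _ _).trans hw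
      have hD := (List.suffix_append _ _).trans hC
      rw [translateAxiom, modelsOntology_cons, modelsOntology_map, modelsTBox_append]
      refine ⟨?_, I.pushforward_models_definitions hT X hC,
        I.pushforward_models_definitions hT X hD⟩
      simp only [SatAxiom, SatGCI] at h ⊢
      rwa [I.ext_pushforward_numeral X hC, I.ext_pushforward_numeral X hD]
    · rw [encAxiom, List.cons_append, List.append_assoc] at hw
      have hC := (List.suffix_cons _ _).trans hw
      rw [translateAxiom, modelsOntology_cons, modelsOntology_map]
      refine ⟨?_, I.pushforward_models_definitions hT X hC⟩
      simp only [SatAxiom] at h ⊢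
      rwa [I.ext_pushforward_numeral X hC]
    · rw [translateAxiom, modelsOntology_cons]
      exact ⟨h, by simp [ModelsOntology]⟩

theorem exists_satisfies_translate (hT : ∀ f v, (T f).eval v = f.1.2 fun i => v (some i))
    (O : Ontology B) (Q : Option (Concept B)) :
    (∃ J : Interp, J.Satisfies (translateOntology T O Q) (Q.map fun _ => numeral 0)) ↔
      ∃ I : Interp, I.Satisfies O Q := by
  constructor
  · rintro ⟨J, hJ⟩
    exact ⟨_, J.pullback_satisfies hT O Q hJ⟩
  · rintro ⟨I, hI, hQ⟩
    -- The query atom denotes the queried concept itself; without a query its extension is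
    -- irrelevant.
    refine ⟨I.pushforward B (encInstance O Q) (Q.elim ∅ I.ext), ?_, ?_⟩
    · refine I.pushforward_models hT _ O Q ?_ hI List.suffix_rfl
      rintro C hC
      rw [Option.mem_def] at hC
      subst hC
      exact subset_rfl
    · rcases Q with _ | C
      · simp
      · intro D hD
        simp only [Option.map_some, Option.mem_def, Option.some.injEq] at hD
        subst hD
        exact hQ C rfl

end Semantics

end ALC

/-! ## The translation as a scanning program -/

namespace ALC

variable {B B' : Finset BoolFun}

/-- A bound on the numbers of items that occur in the program. -/
def maxItems (B : Finset BoolFun) : ℕ := 2 + B.sup Sigma.fst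

theorem Letter.arity_le (a : Letter B) : a.arity ≤ maxItems B := by
  cases a with
  | op f => exact (Finset.le_sup (f := Sigma.fst) f.2).trans (Nat.le_add_left _ _)
  | _ => simp only [Letter.arity, maxItems]; omega

/-- A number of items, cut off at the bound. -/
def itemCount (B : Finset BoolFun) (m : ℕ) : {m : ℕ // m ≤ maxItems B} :=
  ⟨min m (maxItems B), min_le_right _ _⟩

theorem itemCount_val {m : ℕ} (h : m ≤ maxItems B) : (itemCount B m).1 = m := min_eq_left h

/-- Shows that the cut-off in `itemCount` never takes effect during the check. -/
theorem recognize_le {ab q : Bool} {s : Mode} {nz : Bool} {a : Letter B} {r : Mode × ℕ}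
    (h : recognize ab q s nz a = some r) : r.2 ≤ maxItems B := by
  have hb : ∀ b : Bool, b.toNat ≤ maxItems B := fun b =>
    (Bool.toNat_le b).trans (by simp only [maxItems]; omega)
  unfold recognize at h
  split at h
  case h_4 t s f =>
    cases h
    exact Letter.arity_le (.op f)
  all_goals
    first
    | (cases h; first | exact hb _ | (simp only [maxItems]; omega))
    | (split at h <;> cases h; simp only [maxItems]; omega)
    | cases h

open ScanInstr

/-- The instructions that write the name of the suffix after `m` items. -/
def refCode (B : Finset BoolFun) (m : ℕ) : List (ScanInstr (Letter B') (maxItems B)) :=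
  [emit .atom, ref true (itemCount B m)]

/-- The instructions that write the name of the current suffix. -/
def selfCode (B : Finset BoolFun) : List (ScanInstr (Letter B') (maxItems B)) :=
  [emit .atom, emit (.bit true), ref true (itemCount B 0)]

/-- The instructions that write the definition of the current suffix. -/
def defCode (l : List (ScanInstr (Letter B') (maxItems B))) :
    List (ScanInstr (Letter B') (maxItems B)) :=
  emit .gci :: (selfCode B ++ l ++ emit .gci :: (l ++ selfCode B))

/-- The instructions that write a term, applied to the items after the current letter. -/
def termCode (B : Finset BoolFun) {n : ℕ} :
    BoolTerm B' (Option (Fin n)) → List (ScanInstr (Letter B') (maxItems B))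
  | .var none => [emit .atom, emit .endName]
  | .var (some i) => refCode B i
  | .app f ts => emit (.op f) :: (List.ofFn fun i => termCode B (ts i)).flatten

/-- The translation of a letter. -/
def letterCode (T : TermChoice B B') : Letter B → List (ScanInstr (Letter B') (maxItems B))
  | .bit _ => []
  -- Names need no output of their own: the letter that announces them copies them by reference.
  | .endName => []
  | .atom => defCode [emit .atom, emit (.bit false), ref false (itemCount B 0)]
  | .op f => defCode (termCode B (T f))
  | .ex => defCode (emit .ex :: ref false (itemCount B 0) :: refCode B 1)
  | .all => defCode (emit .all :: ref false (itemCount B 0) :: refCode B 1)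
  | .gci => emit .gci :: (refCode B 0 ++ refCode B 1)
  | .conceptAssertion => emit .conceptAssertion :: (refCode B 0 ++ [ref false (itemCount B 1)])
  | .roleAssertion => [emit .roleAssertion, ref false (itemCount B 0), ref false (itemCount B 1),
      ref false (itemCount B 2)]
  | .query => [emit .gci, emit .atom, emit .endName] ++ refCode B 0

/-- The word for the query of a translated instance. -/
def finalWord (B' : Finset BoolFun) (q : Bool) : List (Letter B') :=
  if q then [.query, .atom, .endName] else []

/-- Bits are copied unchanged. -/
def copyBit : Letter B → Option (Letter B')
  | .bit b => some (.bit b)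
  | _ => none

/-- The translation as a scanning program. -/
def program (T : TermChoice B B') (ab q : Bool) {N : ℕ} (hN : ∀ a, (letterCode T a).length ≤ N)
    (hN' : (finalWord B' q).length ≤ N) :
    ScanProgram (Letter B) (Letter B') Mode (maxItems B) N where
  ar a := itemCount B a.arity
  startMode := (false, .zero, false)
  check s nz a := (recognize ab q s nz a).map fun r => (r.1, itemCount B r.2)
  accept := acceptMode q
  code a := ⟨letterCode T a, hN a⟩
  tick := .bit true
  close := .endName
  bit := copyBit
  bad := .endName
  final := finalWord B' q
  length_final := hN'

/-! ### The program outputs the word of the translated instance. -/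

section Program

variable (T : TermChoice B B') (ab q : Bool) {N : ℕ} (hN : ∀ a, (letterCode T a).length ≤ N)
  (hN' : (finalWord B' q).length ≤ N)

theorem program_accepts (s : Mode) (d : ℕ) (w : List (Letter B)) :
    (program T ab q hN hN').accepts s d w = recognizes ab q s d w := by
  induction w generalizing s d with
  | nil => rfl
  | cons a u ih =>
    simp only [ScanProgram.accepts, recognizes, program]
    rcases h : recognize ab q s (d != 0) a with _ | ⟨s', m⟩
    · rfl
    · simp only [Option.map_some]
      rw [itemCount_val (recognize_le h)]
      exact ih _ _

theorem program_exec_emit (u : List (Letter B)) (b : Letter B') :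
    (program T ab q hN hN').exec u (emit b) = [b] := rfl

theorem program_exec_ref (u : List (Letter B)) (k : Bool) {m : ℕ} (hm : m ≤ maxItems B) :
    (program T ab q hN hN').exec u (ref k (itemCount B m)) =
      (program T ab q hN hN').reference k (ScanProgram.skip Letter.arity m u) := by
  have : (fun a : Letter B => ((program T ab q hN hN').ar a).1) = Letter.arity :=
    funext fun a => itemCount_val a.arity_le
  rw [ScanProgram.exec, this, itemCount_val hm]

theorem program_reference_name (x : Name) (r : List (Letter B)) :
    (program T ab q hN hN').reference false (encName x ++ r) = encName x := by
  simp only [ScanProgram.reference, program, Bool.false_eq_true, if_false]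
  induction x with
  | nil => rfl
  | cons b x ih =>
    simp only [encName, List.map_cons, List.cons_append, ScanProgram.copyBits, copyBit] at ih ⊢
    rw [ih]

theorem encConcept_numeral (k : ℕ) :
    encConcept (numeral k : Concept B') =
      .atom :: (List.replicate k (.bit true) ++ [.endName]) := by
  simp [numeral, encConcept, encName]

theorem flatMap_refCode (u : List (Letter B)) {m : ℕ} (hm : m ≤ maxItems B) :
    (refCode B m).flatMap ((program T ab q hN hN').exec u) =
      encConcept (numeral (ScanProgram.skip Letter.arity m u).length) := by
  simp only [refCode, List.flatMap_cons, List.flatMap_nil, program_exec_emit,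
    program_exec_ref _ _ _ _ _ _ _ hm, encConcept_numeral]
  simp [ScanProgram.reference, program]

/-- References start after the current letter, so the extra bit accounts for that letter itself. -/
theorem flatMap_selfCode (u : List (Letter B)) :
    (selfCode B).flatMap ((program T ab q hN hN').exec u) =
      encConcept (numeral (u.length + 1)) := by
  simp only [selfCode, List.flatMap_cons, List.flatMap_nil, program_exec_emit,
    program_exec_ref _ _ _ _ _ _ _ (Nat.zero_le _), encConcept_numeral]
  simp [ScanProgram.reference, program, ScanProgram.skip, List.replicate_succ]

/-- The code `l` is used twice, once per inclusion. This is harmless, as it is a list of bounded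
length fixed by the current letter. -/
theorem flatMap_defCode (u : List (Letter B)) {l : List (ScanInstr (Letter B') (maxItems B))}
    {C : Concept B'} (h : l.flatMap ((program T ab q hN hN').exec u) = encConcept C) :
    (defCode l).flatMap ((program T ab q hN hN').exec u) =
      encTBox (equivalence (numeral (u.length + 1)) C) := by
  simp [defCode, List.flatMap_append, flatMap_selfCode, h, program_exec_emit, encTBox, equivalence,
    encGCI]

theorem flatMap_flatten_ofFn {α β : Type} {n : ℕ} (F : Fin n → List α) (g : α → List β) :
    (List.ofFn F).flatten.flatMap g = (List.ofFn fun i => (F i).flatMap g).flatten := by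
  induction n with
  | zero => simp
  | succ n ih => simp only [List.ofFn_succ, List.flatten_cons, List.flatMap_append, ih]

theorem flatMap_termCode (u : List (Letter B)) {n : ℕ} (hn : n ≤ maxItems B)
    (t : BoolTerm B' (Option (Fin n))) :
    (termCode B t).flatMap ((program T ab q hN hN').exec u) =
      encConcept (t.toConcept (argNames u)) := by
  induction t with
  | var x =>
    rcases x with _ | i
    · simp [termCode, program_exec_emit, BoolTerm.toConcept, argNames, encConcept_numeral]
    · simp only [termCode, BoolTerm.toConcept, argNames]
      exact flatMap_refCode _ _ _ _ _ _ (i.2.le.trans hn)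
  | app f ts ih =>
    rw [termCode, BoolTerm.toConcept, encConcept_op, List.flatMap_cons, program_exec_emit,
      List.singleton_append, encArgs, flatMap_flatten_ofFn]
    simp only [ih]

theorem translate_cons (a : Letter B) (u : List (Letter B)) :
    (program T ab q hN hN').translate (a :: u) =
      (letterCode T a).flatMap ((program T ab q hN hN').exec u) ++
        (program T ab q hN hN').translate u := rfl

theorem translate_encName (x : Name) (r : List (Letter B)) :
    (program T ab q hN hN').translate (encName x ++ r) =
      (program T ab q hN hN').translate r := by
  induction x with
  | nil => simp [encName, translate_cons, letterCode]
  | cons b x ih => simpa [encName, translate_cons, letterCode] using ih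

theorem encTBox_append (S S' : TBox B) : encTBox (S ++ S') = encTBox S ++ encTBox S' :=
  List.flatMap_append

/-- The definitions of a concept are listed in prefix order, outermost first, so a left-to-right
scan produces them one letter at a time. -/
theorem translate_encConcept (C : Concept B) (r : List (Letter B)) :
    (program T ab q hN hN').translate (encConcept C ++ r) =
      encTBox (definitions T C r) ++ (program T ab q hN hN').translate r := by
  have h1 : 1 ≤ maxItems B := by simp only [maxItems]; omega
  induction C generalizing r with
  | atom A =>
    rw [encConcept, List.cons_append, translate_cons, translate_encName, definitions, letterCode,
      flatMap_defCode (C := .atom (false :: A))]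
    · rfl
    · simp only [List.flatMap_cons, List.flatMap_nil, program_exec_emit,
        program_exec_ref _ _ _ _ _ _ _ (Nat.zero_le _), ScanProgram.skip, program_reference_name]
      simp [encConcept, encName]
  | op f Cs ih =>
    have key : ∀ (n : ℕ) (F : Fin n → Concept B), (∀ i (r : List (Letter B)),
        (program T ab q hN hN').translate (encConcept (F i) ++ r) =
          encTBox (definitions T (F i) r) ++ (program T ab q hN hN').translate r) →
        (program T ab q hN hN').translate (encArgs F ++ r) =
          encTBox (List.ofFn fun i => definitions T (F i)
            (ScanProgram.skip Letter.arity (i + 1) (encArgs F ++ r))).flatten ++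
          (program T ab q hN hN').translate r := by
      intro n
      induction n with
      | zero => simp [encArgs, encTBox]
      | succ n ihn =>
        intro F hF
        rw [encArgs_succ, List.append_assoc, hF, ihn _ fun i => hF i.succ, List.ofFn_succ,
          List.flatten_cons, encTBox_append, List.append_assoc]
        -- Skipping the first argument shifts the item counts of the later ones by one.
        simp [skip_encConcept, ScanProgram.skip]
    rw [encConcept_op, List.cons_append, translate_cons, key _ Cs ih, definitions, encTBox_append,
      List.append_assoc, letterCode,
      flatMap_defCode _ _ _ _ _ _ (flatMap_termCode (n := f.1.1) _ _ _ _ _ _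
        (Letter.arity_le (.op f)) (T f))]
    rfl
  | ex R C ih =>
    rw [encConcept, List.cons_append, List.append_assoc, translate_cons, translate_encName,
      definitions, letterCode, ih, encTBox_append, List.append_assoc,
      flatMap_defCode (C := .ex R (numeral (encConcept C ++ r).length))]
    · simp [encConcept]
    · simp only [List.flatMap_cons, program_exec_emit, flatMap_refCode _ _ _ _ _ _ h1,
        program_exec_ref _ _ _ _ _ _ _ (Nat.zero_le _), ScanProgram.skip, program_reference_name]
      rw [skip_encName 0]
      simp [encConcept, ScanProgram.skip]
  | all R C ih =>
    rw [encConcept, List.cons_append, List.append_assoc, translate_cons, translate_encName,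
      definitions, letterCode, ih, encTBox_append, List.append_assoc,
      flatMap_defCode (C := .all R (numeral (encConcept C ++ r).length))]
    · simp [encConcept]
    · simp only [List.flatMap_cons, program_exec_emit, flatMap_refCode _ _ _ _ _ _ h1,
        program_exec_ref _ _ _ _ _ _ _ (Nat.zero_le _), ScanProgram.skip, program_reference_name]
      rw [skip_encName 0]
      simp [encConcept, ScanProgram.skip]

theorem encOntology_append (S S' : Ontology B) :
    encOntology (S ++ S') = encOntology S ++ encOntology S' := List.flatMap_append

theorem encOntology_cons (a : OntAxiom B) (S : Ontology B) :
    encOntology (a :: S) = encAxiom a ++ encOntology S := List.flatMap_cons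

theorem encOntology_map (S : TBox B) : encOntology (S.map .inclusion) = encTBox S := by
  simp [encOntology, encTBox, List.flatMap_map, encAxiom]

theorem translate_encAxiom (a : OntAxiom B) (r : List (Letter B)) :
    (program T ab q hN hN').translate (encAxiom a ++ r) =
      encOntology (translateAxiom T a r) ++ (program T ab q hN hN').translate r := by
  have h1 : 1 ≤ maxItems B := by simp only [maxItems]; omega
  have h2 : 2 ≤ maxItems B := by simp only [maxItems]; omega
  rcases a with ⟨C, D⟩ | ⟨C, x⟩ | ⟨R, x, y⟩
  · rw [encAxiom, encGCI, List.cons_append, List.append_assoc, translate_cons,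
      translate_encConcept, translate_encConcept, translateAxiom, encOntology_cons, encOntology_map,
      encTBox_append, letterCode]
    simp only [List.flatMap_cons, List.flatMap_append, program_exec_emit,
      flatMap_refCode _ _ _ _ _ _ h1, flatMap_refCode _ _ _ _ _ _ (Nat.zero_le _)]
    rw [skip_encConcept 0]
    simp [ScanProgram.skip, encAxiom, encGCI]
  · rw [encAxiom, List.cons_append, List.append_assoc, translate_cons,
      translate_encConcept, translate_encName, translateAxiom, encOntology_cons, encOntology_map,
      letterCode]
    simp only [List.flatMap_cons, List.flatMap_append, List.flatMap_nil, program_exec_emit,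
      program_exec_ref _ _ _ _ _ _ _ h1, flatMap_refCode _ _ _ _ _ _ (Nat.zero_le _)]
    rw [skip_encConcept 0]
    simp [ScanProgram.skip, encAxiom, program_reference_name]
  · rw [encAxiom, List.cons_append, List.append_assoc, List.append_assoc, translate_cons,
      translate_encName, translate_encName, translate_encName, translateAxiom, letterCode]
    simp only [List.flatMap_cons, List.flatMap_nil, program_exec_emit,
      program_exec_ref _ _ _ _ _ _ _ h1, program_exec_ref _ _ _ _ _ _ _ h2,
      program_exec_ref _ _ _ _ _ _ _ (Nat.zero_le _)]
    rw [skip_encName 0, skip_encName 1, skip_encName 0]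
    simp [ScanProgram.skip, encOntology, encAxiom, program_reference_name]

theorem translate_encInstance (O : Ontology B) (Q : Option (Concept B)) :
    (program T ab q hN hN').translate (encInstance O Q) =
      encOntology (translateOntology T O Q) := by
  induction O with
  | nil =>
    rcases Q with _ | C
    · rfl
    · have h := translate_encConcept T ab q hN hN' C []
      rw [List.append_nil] at h
      rw [encInstance, encOntology, List.flatMap_nil, List.nil_append, Option.elim_some, encQuery,
        translate_cons, h, translateOntology, encOntology_map, Option.elim_some, translateQuery,
        letterCode]
      simp [flatMap_refCode, program_exec_emit, ScanProgram.skip, ScanProgram.translate, encTBox,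
        encGCI, encConcept_numeral]
  | cons a O ih =>
    rw [encInstance_cons, translate_encAxiom, translateOntology, encOntology_append, ih]

theorem program_eval_encInstance (O : Ontology B) (Q : Option (Concept B))
    (hO : ab = false → ∀ a ∈ O, a.IsInclusion) (hQ : Q.isSome = q) :
    (program T ab q hN hN').eval (encInstance O Q) =
      encInstance (translateOntology T O Q) (Q.map fun _ => numeral 0) := by
  have h : (program T ab q hN hN').accepts (program T ab q hN hN').startMode 0
      (encInstance O Q) = true :=
    (program_accepts ..).trans (recognizes_encInstance ab q O Q hO hQ)
  rw [ScanProgram.eval, if_pos h, translate_encInstance, encInstance]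
  subst hQ
  rcases Q with _ | C
  · rfl
  · simp [program, finalWord, encQuery, encConcept_numeral]

end Program

/-! ## The reductions -/

/-- The satisfiable instances; `ab` tells whether assertions are allowed, `q` whether there is a
query. -/
def satisfiable (B : Finset BoolFun) (ab q : Bool) : Language (Letter B) :=
  {w | ∃ (O : Ontology B) (Q : Option (Concept B)), w = encInstance O Q ∧
    (ab = false → ∀ a ∈ O, a.IsInclusion) ∧ Q.isSome = q ∧ ∃ I : Interp, I.Satisfies O Q}

theorem translateAxiom_isInclusion (T : TermChoice B B') {a : OntAxiom B} (ha : a.IsInclusion)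
    (r : List (Letter B)) : ∀ b ∈ translateAxiom T a r, b.IsInclusion := by
  rcases a with ⟨C, D⟩ | _ | _
  · intro b hb
    rcases List.mem_cons.1 hb with rfl | hb
    · trivial
    · obtain ⟨c, -, rfl⟩ := List.mem_map.1 hb
      trivial
  · exact ha.elim
  · exact ha.elim

theorem translateOntology_isInclusion (T : TermChoice B B') {O : Ontology B}
    (hO : ∀ a ∈ O, a.IsInclusion) (Q : Option (Concept B)) :
    ∀ b ∈ translateOntology T O Q, b.IsInclusion := by
  induction O with
  | nil =>
    intro b hb
    obtain ⟨c, -, rfl⟩ := List.mem_map.1 hb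
    trivial
  | cons a O ih =>
    intro b hb
    rcases List.mem_append.1 hb with hb | hb
    · exact translateAxiom_isInclusion T (hO a (by simp)) _ b hb
    · exact ih (fun a ha => hO a (by simp [ha])) b hb

theorem logspaceReducible_satisfiable (ab q : Bool)
    (h : (B : Set BoolFun) ⊆ cloneOf (B' : Set BoolFun)) :
    LogspaceReducible (satisfiable B ab q) (satisfiable B' ab q) := by
  choose T hT using fun f : {f : BoolFun // f ∈ B} => BoolTerm.exists_of_mem_cloneOf (h f.2)
  -- The alphabet is finite and the terms depend only on `B` and `B'`, so code lengths are bounded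
  -- independently of the input. The `3` added below makes room for the final word.
  obtain ⟨N, hN⟩ := (Set.finite_range fun a : Letter B => (letterCode T a).length).bddAbove
  have hN₁ : ∀ a, (letterCode T a).length ≤ N + 3 := fun a =>
    (hN ⟨a, rfl⟩).trans (Nat.le_add_right _ _)
  have hN₂ : (finalWord B' q).length ≤ N + 3 := by
    cases q <;> simp [finalWord]
  refine ⟨(program T ab q hN₁ hN₂).eval, ScanProgram.logspaceComputable_eval _, fun w => ?_⟩
  constructor
  · rintro ⟨O, Q, rfl, hO, hQ, hs⟩
    rw [program_eval_encInstance T ab q hN₁ hN₂ O Q hO hQ]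
    exact ⟨_, _, rfl, fun hab => translateOntology_isInclusion T (hO hab) Q, by simpa using hQ,
      (exists_satisfies_translate hT O Q).2 hs⟩
  · rintro ⟨O', Q', he, -, -, hs⟩
    -- The output is known to encode some satisfiable instance. If `w` is well-formed, this is the
    -- translation of `w`; otherwise the output would be `[.endName]`, which encodes none.
    by_cases hw : recognizes ab q (false, .zero, false) 0 w = true
    · obtain ⟨O, Q, rfl, hO, hQ⟩ := exists_encInstance_of_recognizes ab q hw
      rw [program_eval_encInstance T ab q hN₁ hN₂ O Q hO hQ] at he
      obtain ⟨rfl, rfl⟩ := encInstance_inj he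
      exact ⟨O, Q, rfl, hO, hQ, (exists_satisfies_translate hT O Q).1 hs⟩
    · rw [← program_accepts T ab q hN₁ hN₂] at hw
      change ¬(program T ab q hN₁ hN₂).accepts (program T ab q hN₁ hN₂).startMode 0 w = true at hw
      rw [ScanProgram.eval, if_neg hw] at he
      exact (encInstance_ne_endName _ _ he.symm).elim

theorem exists_eq_map_inclusion {O : Ontology B} (hO : ∀ a ∈ O, a.IsInclusion) :
    ∃ S : TBox B, O = S.map .inclusion := by
  induction O with
  | nil => exact ⟨[], rfl⟩
  | cons a O ih =>
    obtain ⟨S, rfl⟩ := ih fun a ha => hO a (by simp [ha])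
    rcases a with c | _ | _
    · exact ⟨c :: S, rfl⟩
    · exact (hO _ List.mem_cons_self).elim
    · exact (hO _ List.mem_cons_self).elim

theorem isInclusion_of_mem_map {S : TBox B} : ∀ a ∈ S.map OntAxiom.inclusion, a.IsInclusion := by
  intro a ha
  obtain ⟨c, -, rfl⟩ := List.mem_map.1 ha
  trivial

/-- A TBox is an ontology all of whose axioms are inclusions, which lets the four problems share one
reduction. -/
theorem TSAT_eq_satisfiable (B : Finset BoolFun) : TSAT B = satisfiable B false false := by
  ext w
  constructor
  · rintro ⟨S, rfl, I, hI⟩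
    exact ⟨S.map .inclusion, none, by simp [encInstance, encOntology_map],
      fun _ => isInclusion_of_mem_map, rfl, I, Interp.modelsOntology_map.2 hI, by simp⟩
  · rintro ⟨O, Q, rfl, hO, hQ, I, hI, -⟩
    obtain ⟨S, rfl⟩ := exists_eq_map_inclusion (hO rfl)
    obtain rfl : Q = none := by simpa using hQ
    exact ⟨S, by simp [encInstance, encOntology_map], I, Interp.modelsOntology_map.1 hI⟩

theorem TCSAT_eq_satisfiable (B : Finset BoolFun) : TCSAT B = satisfiable B false true := by
  ext w
  constructor
  · rintro ⟨S, C, rfl, I, hI, hC⟩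
    exact ⟨S.map .inclusion, some C, by simp [encInstance, encOntology_map],
      fun _ => isInclusion_of_mem_map, rfl, I, Interp.modelsOntology_map.2 hI, by simpa using hC⟩
  · rintro ⟨O, Q, rfl, hO, hQ, I, hI, hC⟩
    obtain ⟨S, rfl⟩ := exists_eq_map_inclusion (hO rfl)
    obtain ⟨C, rfl⟩ := Option.isSome_iff_exists.1 hQ
    exact ⟨S, C, by simp [encInstance, encOntology_map], I, Interp.modelsOntology_map.1 hI,
      hC C rfl⟩

theorem OSAT_eq_satisfiable (B : Finset BoolFun) : OSAT B = satisfiable B true false := by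
  ext w
  constructor
  · rintro ⟨O, rfl, I, hI⟩
    exact ⟨O, none, by simp [encInstance], by simp, rfl, I, hI, by simp⟩
  · rintro ⟨O, Q, rfl, -, hQ, I, hI, -⟩
    obtain rfl : Q = none := by simpa using hQ
    exact ⟨O, by simp [encInstance], I, hI⟩

theorem OCSAT_eq_satisfiable (B : Finset BoolFun) : OCSAT B = satisfiable B true true := by
  ext w
  constructor
  · rintro ⟨O, C, rfl, I, hI, hC⟩
    exact ⟨O, some C, by simp [encInstance], by simp, rfl, I, hI, by simpa using hC⟩
  · rintro ⟨O, Q, rfl, -, hQ, I, hI, hC⟩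
    obtain ⟨C, rfl⟩ := Option.isSome_iff_exists.1 hQ
    exact ⟨O, C, by simp [encInstance], I, hI, hC C rfl⟩

end ALC

theorem mainTheorem4 (B₁ B₂ : Finset BoolFun)
    (h : cloneOf (B₁ : Set BoolFun) = cloneOf (B₂ : Set BoolFun)) :
    LogspaceReducible (ALC.TSAT B₁) (ALC.TSAT B₂) ∧
    LogspaceReducible (ALC.TCSAT B₁) (ALC.TCSAT B₂) ∧
    LogspaceReducible (ALC.OSAT B₁) (ALC.OSAT B₂) ∧
    LogspaceReducible (ALC.OCSAT B₁) (ALC.OCSAT B₂) := by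
  have hB : (B₁ : Set BoolFun) ⊆ cloneOf (B₂ : Set BoolFun) :=
    h ▸ Set.subset_sInter fun _ hC => hC.2
  simp only [ALC.TSAT_eq_satisfiable, ALC.TCSAT_eq_satisfiable, ALC.OSAT_eq_satisfiable,
    ALC.OCSAT_eq_satisfiable]
  exact ⟨ALC.logspaceReducible_satisfiable _ _ hB, ALC.logspaceReducible_satisfiable _ _ hB,
    ALC.logspaceReducible_satisfiable _ _ hB, ALC.logspaceReducible_satisfiable _ _ hB⟩
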